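/- Let $\Bbbk=\mathbb C(q^{1/2})$, $\widetilde q=-q^{-1}$, ${\bf v}=\sqrt{-1}\,q^{1/2}$, $[m]=\frac{q^m-q^{-m}}{q-q^{-1}}$, and $[X,Y]_t=XY-tYX$, $[X,Y]=[X,Y]_1$. **The algebra $\mathcal U_D(\epsilon)$.** Let $n\ge 4$ and $\epsilon=(\epsilon_1,\dots,\epsilon_n)\in\{0,1\}^n$. Let $P=\mathbb Z\Lambda\oplus\bigoplus_{i=1}^n\mathbb Z\delta_i$, with $(\delta_i|\delta_j)=(-1)^{\epsilon_i}\delta_{ij}$; put $q_i=q$ if $\epsilon_i=0$, $q_i=\widetilde q$ if $\epsilon_i=1$, and for $\mu=\ell\Lambda+\sum\mu_i\delta_i$, $\nu=\ell'\Lambda+\sum\nu_i\delta_i$ put ${\bf q}(\mu,\nu)={\bf v}^{\sum_j(\ell'\mu_j+\ell\nu_j)}\prod_i q_i^{\mu_i\nu_i}$. Let $\alpha_0=\delta_1+\delta_2$, $\alpha_i=\delta_{i+1}-\delta_i$ $(0<i<n)$, $\alpha_n=-\delta_n-\delta_{n-1}$. Then $\mathcal U_D(\epsilon)$ is the associative unital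 $\Bbbk$-algebra generated by $e_i,f_i$ $(0\le i\le n)$ and $k_\mu$ $(\mu\in P)$ subject to the following relations, where $k_i=k_{\alpha_i}$: $k_0=1$ (index $\mu=0$), $k_{\mu+\mu'}=k_\mu k_{\mu'}$; $k_\mu e_ik_{-\mu}={\bf q}(\mu,\alpha_i)e_i$; $k_\mu f_ik_{-\mu}={\bf q}(\mu,\alpha_i)^{-1}f_i$; $e_if_j-f_je_i=\delta_{ij}\frac{k_{i}-k_{i}^{-1}}{q-q^{-1}}$; and the following relations together with those obtained by replacing every $e$ by $f$: - $e_i^2=0$ if $(\alpha_i|\alpha_i)=0$; $[e_i,e_j]=0$ if $(\alpha_i|\alpha_j)=0$; - $e_0^2e_2-(-1)^{\epsilon_1}[2]e_0e_2e_0+e_2e_0^2=0$ if $\epsilon_1=\epsilon_2$; $e_2^2e_0-(-1)^{\epsilon_2}[2]e_2e_0e_2+e_0e_2^2=0$ if $\epsilon_2=\epsilon_3$; - $e_i^2e_j-(-1)^{\epsilon_i}[2]e_ie_je_i+e_je_i^2=0$ if $0<i,j<n$, $|i-j|=1$, $\epsilon_i=\epsilon_{i+1}$; - $e_{n-2}^2e_n-(-1)^{\epsilon_{n-2}}[2]e_{n-2}e_ne_{n-2}+e_ne_{n-2}^2=0$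 if $\epsilon_{n-2}=\epsilon_{n-1}$; $e_n^2e_{n-2}-(-1)^{\epsilon_{n-1}}[2]e_ne_{n-2}e_n+e_{n-2}e_n^2=0$ if $\epsilon_{n-1}=\epsilon_n$; - $e_0e_1e_2-e_1e_0e_2+(-1)^{\epsilon_2}[2](e_1e_2e_0-e_0e_2e_1)+e_2e_0e_1-e_2e_1e_0=0$ if $\epsilon_1\ne\epsilon_2$; - $e_0e_2e_3e_2-e_3e_2e_0e_2+(-1)^{\epsilon_3}[2]e_2e_3e_0e_2-e_2e_0e_2e_3+e_2e_3e_2e_0=0$ if $\epsilon_2\neq\epsilon_3$; - $e_ie_{i-1}e_ie_{i+1}-e_ie_{i+1}e_ie_{i-1}+(-1)^{\epsilon_i}[2]e_ie_{i-1}e_{i+1}e_i-e_{i-1}e_ie_{i+1}e_i+e_{i+1}e_ie_{i-1}e_i=0$ if $2\le i\le n-2$, $\epsilon_i\ne\epsilon_{i+1}$; - $e_{n-2}e_{n-3}e_{n-2}e_n-e_{n-2}e_ne_{n-2}e_{n-3}+(-1)^{\epsilon_{n-2}}[2]e_{n-2}e_{n-3}e_ne_{n-2}-e_{n-3}e_{n-2}e_ne_{n-2}+e_ne_{n-2}e_{n-3}e_{n-2}=0$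 if $\epsilon_{n-2}\ne\epsilon_{n-1}$; - $e_{n-2}e_ne_{n-1}-e_{n-2}e_{n-1}e_n+(-1)^{\epsilon_{n-1}}[2](e_{n-1}e_{n-2}e_n-e_ne_{n-2}e_{n-1})+e_ne_{n-1}e_{n-2}-e_{n-1}e_ne_{n-2}=0$ if $\epsilon_{n-1}\neq\epsilon_n$. **Quantum affine algebras.** For $p\in\{q,\widetilde q\}$, $U_p(X_N^{(1)})$ denotes the Drinfeld–Jimbo quantum affine algebra over $\Bbbk$ (without derivation), generated by $e_i,f_i,k_i^{\pm1}$ $(0\le i\le N)$, with pairwise commuting $k_i$, $k_ie_jk_i^{-1}=p_i^{a_{ij}}e_j$, $k_if_jk_i^{-1}=p_i^{-a_{ij}}f_j$, $e_if_j-f_je_i=\delta_{ij}\frac{k_i-k_i^{-1}}{p_i-p_i^{-1}}$ and the quantum Serre relations in the $e_i$ and in the $f_i$ with $p_i$-binomial coefficients. Its Cartan matrix is $a_{ij}=2(\beta_i,\beta_j)/(\beta_i,\beta_i)$ and $p_i=p^{(\beta_i,\beta_i)/2}$, where, in $\mathbb Z^N$ with its standard basis $(\varepsilon_i)$ and standard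 inner product, $\beta_i=\varepsilon_{i+1}-\varepsilon_i$ for $0<i<N$ and: for $C_N^{(1)}$, $\beta_0=2\varepsilon_1$, $\beta_N=-2\varepsilon_N$ (so $p_0=p_N=p^2$, and $p_i=p$ otherwise); for $D_N^{(1)}$, $\beta_0=\varepsilon_1+\varepsilon_2$, $\beta_N=-\varepsilon_N-\varepsilon_{N-1}$ (so all $p_i=p$). **Statement.** Let $m\ge2$, $n=2m+1$, ${\bm\epsilon}=(1,0,1,\dots,0,1)$ and ${\bm\epsilon}'=(0,1,0,\dots,1,0)$, both of length $n$. Let $\eta\in\{1,-1\}$. (1) There is a homomorphism of $\Bbbk$-algebras $\phi_{\underline{\bm\epsilon}}:U_q(C_m^{(1)})\to\mathcal U_D({\bm\epsilon})$ such that for $0\le i\le m$ $$e_i\mapsto \tfrac{1}{[2]^{\delta_{i0}+\delta_{im}}}[e_{2i},e_{2i+1}]_{c_i},\quad f_i\mapsto \tfrac{1}{[2]^{\delta_{i0}+\delta_{im}}}[f_{2i+1},f_{2i}]_{c_i^{-1}},\quad k_i\mapsto k_{2i}k_{2i+1},$$ where $c_i=-q^{2\eta}$ for $i=0,m$ and $c_i=-q^{\eta}$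 otherwise. (2) Let $d=q$ or $d=q^{-1}$. There is a homomorphism of $\Bbbk$-algebras $\phi_{\overline{\bm\epsilon}}:U_{\widetilde q}(D_{m+1}^{(1)})\to\mathcal U_D({\bm\epsilon})$ such that for $0\le j\le m+1$ $$e_j\mapsto[e_a,e_b]_d,\quad f_j\mapsto[f_b,f_a]_{d^{-1}},\quad k_j\mapsto k_ak_b,$$ where $(a,b)=(0,2)$ if $j=0$, $(a,b)=(2j-1,2j)$ if $1\le j\le m$, and $(a,b)=(2m-1,2m+1)$ if $j=m+1$. (3) There is a homomorphism of $\Bbbk$-algebras $\phi_{\overline{\bm\epsilon}'}:U_{\widetilde q}(C_m^{(1)})\to\mathcal U_D({\bm\epsilon}')$ such that for $0\le i\le m$ $$e_i\mapsto \left(-\tfrac{1}{[2]}\right)^{\delta_{i0}+\delta_{im}}[e_{2i+1},e_{2i}]_{c_i},\quad f_i\mapsto \left(-\tfrac{1}{[2]}\right)^{\delta_{i0}+\delta_{im}}[f_{2i},f_{2i+1}]_{c_i^{-1}},\quad k_i\mapsto k_{2i}k_{2i+1},$$ where $c_i=-q^{2\eta}$ for $i=0,m$ and $c_i=q^{\eta}$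 otherwise. (4) Let $d=-q$ or $d=-q^{-1}$. There is a homomorphism of $\Bbbk$-algebras $\phi_{\underline{\bm\epsilon}'}:U_{q}(D_{m+1}^{(1)})\to\mathcal U_D({\bm\epsilon}')$ such that for $0\le j\le m+1$ $$e_j\mapsto[e_b,e_a]_d,\quad f_j\mapsto[f_a,f_b]_{d^{-1}},\quad k_j\mapsto k_ak_b,$$ with $(a,b)$ as in (2). -/

import Mathlib

noncomputable section

namespace QuantumD

/-! ## The ground field and `q`-numbers -/

/-- The field `ℂ(q^{1/2})`; the indeterminate `RatFunc.X` is `q^{1/2}`. -/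
abbrev Kq : Type := RatFunc ℂ

/-- `q = (q^{1/2})^2`. -/
def q : Kq := RatFunc.X ^ 2

/-- `q̃ = -q⁻¹`. -/
def qt : Kq := -q⁻¹

/-- `𝐯 = i q^{1/2}`. -/
def vv : Kq := RatFunc.C Complex.I * RatFunc.X

/-- The `p`-integer `[m]_p = (p^m - p^{-m}) / (p - p⁻¹)`. -/
def qint (p : Kq) (m : ℕ) : Kq := (p ^ m - p⁻¹ ^ m) / (p - p⁻¹)

/-- The `p`-factorial `[m]_p! = [m]_p [m-1]_p ⋯ [1]_p`. -/
def qfact (p : Kq) (m : ℕ) : Kq := ∏ i ∈ Finset.range m, qint p (i + 1)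

/-- The `p`-binomial coefficient `[m]_p [m-1]_p ⋯ [m-k+1]_p / [k]_p!` for `k ≤ m`. -/
def qbinom (p : Kq) (m k : ℕ) : Kq :=
  (∏ i ∈ Finset.range k, qint p (m - i)) / qfact p k

/-- The `t`-commutator `[X, Y]_t = X Y - t Y X`. -/
def qcomm {A : Type} [Ring A] [Algebra Kq A] (t : Kq) (x y : A) : A :=
  x * y - t • (y * x)

/-! ## The generalized quantum group `𝓤_D(ε)` of affine type `D` -/

/-- `unitVec n i` is the standard basis vector with (one-based) index `i ∈ {1, …, n}`
of `ℤ^n`. -/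
def unitVec (n i : ℕ) : Fin n → ℤ := fun j => if j.val + 1 = i then 1 else 0

/-- The simple roots of (affine) type `D_n` modulo the null root, in `ℤ^n`:
`α_0 = δ_1 + δ_2`, `α_i = δ_{i+1} - δ_i` for `0 < i < n`, `α_n = -δ_n - δ_{n-1}`. -/
def rootD (n i : ℕ) : Fin n → ℤ :=
  if i = 0 then unitVec n 1 + unitVec n 2
  else if i = n then -unitVec n n - unitVec n (n - 1)
  else unitVec n (i + 1) - unitVec n i

/-- The lattice `P = ℤΛ ⊕ ℤδ_1 ⊕ ⋯ ⊕ ℤδ_n`: the pair `(ℓ, μ)` is `ℓ Λ + ∑ μ_i δ_i`. -/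
abbrev Lat (n : ℕ) : Type := ℤ × (Fin n → ℤ)

/-- `(-1)^{ε_i}`.  A parity sequence `(ε_1, …, ε_n)` is given as a function on `ℕ`, of which
only the values at `1, …, n` are used. -/
def sgn (ε : ℕ → Fin 2) (i : ℕ) : ℤ := (-1) ^ (ε i).val

/-- The bilinear form on `⊕ ℤ δ_i` with `(δ_i | δ_j) = (-1)^{ε_i} δ_{ij}`. -/
def form (n : ℕ) (ε : ℕ → Fin 2) (μ ν : Fin n → ℤ) : ℤ :=
  ∑ j : Fin n, sgn ε (j.val + 1) * μ j * ν j

/-- `q_i`, equal to `q` if `ε_i = 0` and to `q̃` if `ε_i = 1`. -/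
def qi (ε : ℕ → Fin 2) (i : ℕ) : Kq := if ε i = 0 then q else qt

/-- The symmetric biadditive function `𝐪 : P × P → 𝕜^×`. -/
def qform (n : ℕ) (ε : ℕ → Fin 2) (μ ν : Lat n) : Kq :=
  vv ^ (∑ j : Fin n, (ν.1 * μ.2 j + μ.1 * ν.2 j)) *
    ∏ j : Fin n, qi ε (j.val + 1) ^ (μ.2 j * ν.2 j)

/-- The simple root `α_i` as an element of `P`. -/
def rootP (n i : ℕ) : Lat n := (0, rootD n i)

/-- `(-1)^{ε_i} [2]`. -/
def stwo (ε : ℕ → Fin 2) (i : ℕ) : Kq := (sgn ε i : Kq) * qint q 2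

/-- The defining relations that involve only the `e_i` or only the `f_i`: `HalfRel n ε x r` says
that `r = 0` is one of these relations, written for the family `x_0, …, x_n`
(`x = e` or `x = f`). -/
inductive HalfRel (n : ℕ) (ε : ℕ → Fin 2) {A : Type} [Ring A] [Algebra Kq A] (x : ℕ → A) :
    A → Prop
  | odd_sq (i : ℕ) (hi : i ≤ n) (h : form n ε (rootD n i) (rootD n i) = 0) :
      HalfRel n ε x (x i ^ 2)
  | comm (i j : ℕ) (hi : i ≤ n) (hj : j ≤ n) (h : form n ε (rootD n i) (rootD n j) = 0) :
      HalfRel n ε x (x i * x j - x j * x i)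
  | cubic_0_2 (h : ε 1 = ε 2) :
      HalfRel n ε x (x 0 ^ 2 * x 2 - stwo ε 1 • (x 0 * x 2 * x 0) + x 2 * x 0 ^ 2)
  | cubic_2_0 (h : ε 2 = ε 3) :
      HalfRel n ε x (x 2 ^ 2 * x 0 - stwo ε 2 • (x 2 * x 0 * x 2) + x 0 * x 2 ^ 2)
  | cubic (i j : ℕ) (hi : 1 ≤ i ∧ i < n) (hj : 1 ≤ j ∧ j < n) (hij : i + 1 = j ∨ j + 1 = i)
      (h : ε i = ε (i + 1)) :
      HalfRel n ε x (x i ^ 2 * x j - stwo ε i • (x i * x j * x i) + x j * x i ^ 2)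
  | cubic_tail (h : ε (n - 2) = ε (n - 1)) :
      HalfRel n ε x (x (n - 2) ^ 2 * x n - stwo ε (n - 2) • (x (n - 2) * x n * x (n - 2))
        + x n * x (n - 2) ^ 2)
  | cubic_tail' (h : ε (n - 1) = ε n) :
      HalfRel n ε x (x n ^ 2 * x (n - 2) - stwo ε (n - 1) • (x n * x (n - 2) * x n)
        + x (n - 2) * x n ^ 2)
  | head_fork (h : ε 1 ≠ ε 2) :
      HalfRel n ε x (x 0 * x 1 * x 2 - x 1 * x 0 * x 2
        + stwo ε 2 • (x 1 * x 2 * x 0 - x 0 * x 2 * x 1)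
        + x 2 * x 0 * x 1 - x 2 * x 1 * x 0)
  | head_quartic (h : ε 2 ≠ ε 3) :
      HalfRel n ε x (x 0 * x 2 * x 3 * x 2 - x 3 * x 2 * x 0 * x 2
        + stwo ε 3 • (x 2 * x 3 * x 0 * x 2)
        - x 2 * x 0 * x 2 * x 3 + x 2 * x 3 * x 2 * x 0)
  | quartic (i : ℕ) (hi : 2 ≤ i ∧ i ≤ n - 2) (h : ε i ≠ ε (i + 1)) :
      HalfRel n ε x (x i * x (i - 1) * x i * x (i + 1) - x i * x (i + 1) * x i * x (i - 1)
        + stwo ε i • (x i * x (i - 1) * x (i + 1) * x i)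
        - x (i - 1) * x i * x (i + 1) * x i + x (i + 1) * x i * x (i - 1) * x i)
  | tail_quartic (h : ε (n - 2) ≠ ε (n - 1)) :
      HalfRel n ε x (x (n - 2) * x (n - 3) * x (n - 2) * x n
        - x (n - 2) * x n * x (n - 2) * x (n - 3)
        + stwo ε (n - 2) • (x (n - 2) * x (n - 3) * x n * x (n - 2))
        - x (n - 3) * x (n - 2) * x n * x (n - 2) + x n * x (n - 2) * x (n - 3) * x (n - 2))
  | tail_fork (h : ε (n - 1) ≠ ε n) :
      HalfRel n ε x (x (n - 2) * x n * x (n - 1) - x (n - 2) * x (n - 1) * x n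
        + stwo ε (n - 1) • (x (n - 1) * x (n - 2) * x n - x n * x (n - 2) * x (n - 1))
        + x n * x (n - 1) * x (n - 2) - x (n - 1) * x n * x (n - 2))

/-- The generators `e_i`, `f_i` (`0 ≤ i ≤ n`) and `k_μ` (`μ ∈ P`) of `𝓤_D(ε)`. -/
inductive DGen (n : ℕ) : Type
  | e (i : Fin (n + 1))
  | f (i : Fin (n + 1))
  | k (μ : Lat n)

/-- The free associative algebra on the generators of `𝓤_D(ε)`. -/
abbrev DFree (n : ℕ) : Type := FreeAlgebra Kq (DGen n)

/-- The letter `e_i`, for `i ≤ n`. -/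
def DFree.e (n i : ℕ) : DFree n := FreeAlgebra.ι Kq (DGen.e (Fin.ofNat (n + 1) i))

/-- The letter `f_i`, for `i ≤ n`. -/
def DFree.f (n i : ℕ) : DFree n := FreeAlgebra.ι Kq (DGen.f (Fin.ofNat (n + 1) i))

/-- The letter `k_μ`. -/
def DFree.k (n : ℕ) (μ : Lat n) : DFree n := FreeAlgebra.ι Kq (DGen.k μ)

/-- The defining relations of `𝓤_D(ε)`, for `n ≥ 4`. -/
inductive DRel (n : ℕ) (ε : ℕ → Fin 2) : DFree n → DFree n → Prop
  | k_zero : DRel n ε (DFree.k n 0) 1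
  | k_add (μ ν : Lat n) : DRel n ε (DFree.k n (μ + ν)) (DFree.k n μ * DFree.k n ν)
  | k_e (μ : Lat n) (i : ℕ) (hi : i ≤ n) :
      DRel n ε (DFree.k n μ * DFree.e n i * DFree.k n (-μ))
        (qform n ε μ (rootP n i) • DFree.e n i)
  | k_f (μ : Lat n) (i : ℕ) (hi : i ≤ n) :
      DRel n ε (DFree.k n μ * DFree.f n i * DFree.k n (-μ))
        ((qform n ε μ (rootP n i))⁻¹ • DFree.f n i)
  | e_f (i : ℕ) (hi : i ≤ n) :
      DRel n ε (DFree.e n i * DFree.f n i - DFree.f n i * DFree.e n i)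
        ((q - q⁻¹)⁻¹ • (DFree.k n (rootP n i) - DFree.k n (-rootP n i)))
  | e_f_ne (i j : ℕ) (hi : i ≤ n) (hj : j ≤ n) (hij : i ≠ j) :
      DRel n ε (DFree.e n i * DFree.f n j - DFree.f n j * DFree.e n i) 0
  | half_e (r : DFree n) (hr : HalfRel n ε (DFree.e n) r) : DRel n ε r 0
  | half_f (r : DFree n) (hr : HalfRel n ε (DFree.f n) r) : DRel n ε r 0

/-- The generalized quantum group `𝓤_D(ε)` of affine type `D` associated with
`ε = (ε_1, …, ε_n)`, `n ≥ 4`. -/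
abbrev UD (n : ℕ) (ε : ℕ → Fin 2) : Type := RingQuot (DRel n ε)

/-- The generator `e_i` of `𝓤_D(ε)`, for `i ≤ n`. -/
def UD.e (n : ℕ) (ε : ℕ → Fin 2) (i : ℕ) : UD n ε :=
  RingQuot.mkAlgHom Kq (DRel n ε) (DFree.e n i)

/-- The generator `f_i` of `𝓤_D(ε)`, for `i ≤ n`. -/
def UD.f (n : ℕ) (ε : ℕ → Fin 2) (i : ℕ) : UD n ε :=
  RingQuot.mkAlgHom Kq (DRel n ε) (DFree.f n i)

/-- The element `k_i = k_{α_i}` of `𝓤_D(ε)`, for `i ≤ n`. -/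
def UD.k (n : ℕ) (ε : ℕ → Fin 2) (i : ℕ) : UD n ε :=
  RingQuot.mkAlgHom Kq (DRel n ε) (DFree.k n (rootP n i))

/-! ## Drinfeld–Jimbo quantum affine algebras (without derivation) -/

/-- The generators `e_i`, `f_i`, `k_i`, `k_i⁻¹`. -/
inductive DJGen (J : Type) : Type
  | e (i : J)
  | f (i : J)
  | k (i : J)
  | kinv (i : J)

/-- The free associative algebra on the Drinfeld–Jimbo generators. -/
abbrev DJFree (J : Type) : Type := FreeAlgebra Kq (DJGen J)

/-- The letter `e_i`. -/
def DJFree.e {J : Type} (i : J) : DJFree J := FreeAlgebra.ι Kq (DJGen.e i)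

/-- The letter `f_i`. -/
def DJFree.f {J : Type} (i : J) : DJFree J := FreeAlgebra.ι Kq (DJGen.f i)

/-- The letter `k_i`. -/
def DJFree.k {J : Type} (i : J) : DJFree J := FreeAlgebra.ι Kq (DJGen.k i)

/-- The letter `k_i⁻¹`. -/
def DJFree.kinv {J : Type} (i : J) : DJFree J := FreeAlgebra.ι Kq (DJGen.kinv i)

/-- The quantum Serre expression
`∑_r (-1)^r [1 - a choose r]_p  x^{1-a-r} y x^r` for a Cartan integer `a ≤ 0`. -/
def serre {A : Type} [Ring A] [Algebra Kq A] (p : Kq) (a : ℤ) (x y : A) : A :=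
  ∑ r ∈ Finset.range ((1 - a).toNat + 1),
    ((-1) ^ r * qbinom p (1 - a).toNat r) • (x ^ ((1 - a).toNat - r) * y * x ^ r)

/-- The defining relations of the Drinfeld–Jimbo algebra with parameter `p` of the symmetrizable
generalized Cartan matrix `a`, with symmetrizer `d` (so that `d_i a_{ij} = d_j a_{ji}`)
and `p_i = p^{d_i}`. -/
inductive DJRel {J : Type} (a : Matrix J J ℤ) (d : J → ℤ) (p : Kq) :
    DJFree J → DJFree J → Prop
  | k_kinv (i : J) : DJRel a d p (DJFree.k i * DJFree.kinv i) 1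
  | kinv_k (i : J) : DJRel a d p (DJFree.kinv i * DJFree.k i) 1
  | k_k (i j : J) : DJRel a d p (DJFree.k i * DJFree.k j) (DJFree.k j * DJFree.k i)
  | k_e (i j : J) : DJRel a d p (DJFree.k i * DJFree.e j * DJFree.kinv i)
      ((p ^ d i) ^ a i j • DJFree.e j)
  | k_f (i j : J) : DJRel a d p (DJFree.k i * DJFree.f j * DJFree.kinv i)
      ((p ^ d i) ^ (-a i j) • DJFree.f j)
  | e_f (i : J) : DJRel a d p (DJFree.e i * DJFree.f i - DJFree.f i * DJFree.e i)
      ((p ^ d i - (p ^ d i)⁻¹)⁻¹ • (DJFree.k i - DJFree.kinv i))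
  | e_f_ne (i j : J) (hij : i ≠ j) :
      DJRel a d p (DJFree.e i * DJFree.f j - DJFree.f j * DJFree.e i) 0
  | serre_e (i j : J) (hij : i ≠ j) :
      DJRel a d p (serre (p ^ d i) (a i j) (DJFree.e i) (DJFree.e j)) 0
  | serre_f (i j : J) (hij : i ≠ j) :
      DJRel a d p (serre (p ^ d i) (a i j) (DJFree.f i) (DJFree.f j)) 0

/-- The Drinfeld–Jimbo algebra of `(a, d)` over `ℂ(q^{1/2})` with quantum parameter `p`. -/
abbrev DJ {J : Type} (a : Matrix J J ℤ) (d : J → ℤ) (p : Kq) : Type :=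
  RingQuot (DJRel a d p)

/-- The Cartan matrix `a_{ij} = 2 (α_i, α_j) / (α_i, α_i)` of a family of vectors in the Euclidean
lattice `ℤ^N`. -/
def cartan {J : Type} {N : ℕ} (α : J → Fin N → ℤ) : Matrix J J ℤ :=
  fun i j => 2 * (α i ⬝ᵥ α j) / (α i ⬝ᵥ α i)

/-- The symmetrizer `d_i = (α_i, α_i) / 2` of a family of vectors in `ℤ^N`. -/
def symmetrizer {J : Type} {N : ℕ} (α : J → Fin N → ℤ) : J → ℤ :=
  fun i => (α i ⬝ᵥ α i) / 2

/-- The simple roots of type `C_m^{(1)}` modulo the null root, in `ℤ^m`: `α_0 = 2 δ_1`,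
`α_i = δ_{i+1} - δ_i` for `0 < i < m`, `α_m = -2 δ_m`. The roots `α_0`, `α_m` are long. -/
def simpleC (m : ℕ) (i : Fin (m + 1)) : Fin m → ℤ :=
  if i.val = 0 then 2 • unitVec m 1
  else if i.val = m then -(2 • unitVec m m)
  else unitVec m (i.val + 1) - unitVec m i.val

/-- The simple roots of type `D_N^{(1)}` modulo the null root, in `ℤ^N`. -/
def simpleD (N : ℕ) (i : Fin (N + 1)) : Fin N → ℤ := rootD N i.val

/-- The quantum affine algebra `U_p(C_m^{(1)})`, normalized by `p_0 = p_m = p^2` and `p_i = p`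
for `0 < i < m`. -/
abbrev UqC (p : Kq) (m : ℕ) : Type := DJ (cartan (simpleC m)) (symmetrizer (simpleC m)) p

/-- The quantum affine algebra `U_p(D_N^{(1)})`, with `p_i = p` for all `i`. -/
abbrev UqD (p : Kq) (N : ℕ) : Type := DJ (cartan (simpleD N)) (symmetrizer (simpleD N)) p

/-- The generator `e_i`. -/
def DJ.e {J : Type} (a : Matrix J J ℤ) (d : J → ℤ) (p : Kq) (i : J) : DJ a d p :=
  RingQuot.mkAlgHom Kq (DJRel a d p) (DJFree.e i)

/-- The generator `f_i`. -/
def DJ.f {J : Type} (a : Matrix J J ℤ) (d : J → ℤ) (p : Kq) (i : J) : DJ a d p :=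
  RingQuot.mkAlgHom Kq (DJRel a d p) (DJFree.f i)

/-- The generator `k_i`. -/
def DJ.k {J : Type} (a : Matrix J J ℤ) (d : J → ℤ) (p : Kq) (i : J) : DJ a d p :=
  RingQuot.mkAlgHom Kq (DJRel a d p) (DJFree.k i)

/-- `φ` sends the generators `e_i`, `f_i`, `k_i` of a Drinfeld–Jimbo algebra to `E_i`, `F_i`,
`K_i`. -/
def SendsGenerators {J : Type} {a : Matrix J J ℤ} {d : J → ℤ} {p : Kq} {B : Type} [Ring B]
    [Algebra Kq B] (φ : DJ a d p →ₐ[Kq] B) (E F K : J → B) : Prop :=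
  ∀ i, φ (DJ.e a d p i) = E i ∧ φ (DJ.f a d p i) = F i ∧ φ (DJ.k a d p i) = K i

/-! ## The alternating sequences and the images of the generators -/

/-- The alternating sequence `(1, 0, 1, …)`. -/
def epsC (i : ℕ) : Fin 2 := if i % 2 = 1 then 1 else 0

/-- The alternating sequence `(0, 1, 0, …)`. -/
def epsD (i : ℕ) : Fin 2 := if i % 2 = 1 then 0 else 1

/-- `δ_{i0} + δ_{im}`. -/
def ends (m i : ℕ) : ℕ := (if i = 0 then 1 else 0) + (if i = m then 1 else 0)

namespace TypeC

/-- `c_i = -q^{2η}` for `i = 0, m`, and `c_i = -q^η` otherwise. -/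
def c (m : ℕ) (η : ℤ) (i : ℕ) : Kq := if i = 0 ∨ i = m then -q ^ (2 * η) else -q ^ η

/-- `ê_i`. -/
def hatE (m : ℕ) (η : ℤ) (i : Fin (m + 1)) : UD (2 * m + 1) epsC :=
  (1 / qint q 2 ^ ends m i) •
    qcomm (c m η i) (UD.e (2 * m + 1) epsC (2 * i.val)) (UD.e (2 * m + 1) epsC (2 * i.val + 1))

/-- `f̂_i`. -/
def hatF (m : ℕ) (η : ℤ) (i : Fin (m + 1)) : UD (2 * m + 1) epsC :=
  (1 / qint q 2 ^ ends m i) •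
    qcomm (c m η i)⁻¹ (UD.f (2 * m + 1) epsC (2 * i.val + 1)) (UD.f (2 * m + 1) epsC (2 * i.val))

/-- `k̂_i`. -/
def hatK (m : ℕ) (i : Fin (m + 1)) : UD (2 * m + 1) epsC :=
  UD.k (2 * m + 1) epsC (2 * i.val) * UD.k (2 * m + 1) epsC (2 * i.val + 1)

/-- `ě_j`. -/
def checkE (m : ℕ) (d : Kq) (j : Fin (m + 1 + 1)) : UD (2 * m + 1) epsC :=
  if j.val = 0 then qcomm d (UD.e (2 * m + 1) epsC 0) (UD.e (2 * m + 1) epsC 2)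
  else if j.val = m + 1 then
    qcomm d (UD.e (2 * m + 1) epsC (2 * m - 1)) (UD.e (2 * m + 1) epsC (2 * m + 1))
  else qcomm d (UD.e (2 * m + 1) epsC (2 * j.val - 1)) (UD.e (2 * m + 1) epsC (2 * j.val))

/-- `f̌_j`. -/
def checkF (m : ℕ) (d : Kq) (j : Fin (m + 1 + 1)) : UD (2 * m + 1) epsC :=
  if j.val = 0 then qcomm d⁻¹ (UD.f (2 * m + 1) epsC 2) (UD.f (2 * m + 1) epsC 0)
  else if j.val = m + 1 then
    qcomm d⁻¹ (UD.f (2 * m + 1) epsC (2 * m + 1)) (UD.f (2 * m + 1) epsC (2 * m - 1))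
  else qcomm d⁻¹ (UD.f (2 * m + 1) epsC (2 * j.val)) (UD.f (2 * m + 1) epsC (2 * j.val - 1))

/-- `ǩ_j`. -/
def checkK (m : ℕ) (j : Fin (m + 1 + 1)) : UD (2 * m + 1) epsC :=
  if j.val = 0 then UD.k (2 * m + 1) epsC 0 * UD.k (2 * m + 1) epsC 2
  else if j.val = m + 1 then
    UD.k (2 * m + 1) epsC (2 * m - 1) * UD.k (2 * m + 1) epsC (2 * m + 1)
  else UD.k (2 * m + 1) epsC (2 * j.val - 1) * UD.k (2 * m + 1) epsC (2 * j.val)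

end TypeC

namespace TypeD

/-- `c_i = -q^{2η}` for `i = 0, m`, and `c_i = q^η` otherwise. -/
def c (m : ℕ) (η : ℤ) (i : ℕ) : Kq := if i = 0 ∨ i = m then -q ^ (2 * η) else q ^ η

/-- `ê_i`. -/
def hatE (m : ℕ) (η : ℤ) (i : Fin (m + 1)) : UD (2 * m + 1) epsD :=
  (-(1 / qint q 2)) ^ ends m i •
    qcomm (c m η i) (UD.e (2 * m + 1) epsD (2 * i.val + 1)) (UD.e (2 * m + 1) epsD (2 * i.val))

/-- `f̂_i`. -/
def hatF (m : ℕ) (η : ℤ) (i : Fin (m + 1)) : UD (2 * m + 1) epsD :=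
  (-(1 / qint q 2)) ^ ends m i •
    qcomm (c m η i)⁻¹ (UD.f (2 * m + 1) epsD (2 * i.val)) (UD.f (2 * m + 1) epsD (2 * i.val + 1))

/-- `k̂_i`. -/
def hatK (m : ℕ) (i : Fin (m + 1)) : UD (2 * m + 1) epsD :=
  UD.k (2 * m + 1) epsD (2 * i.val) * UD.k (2 * m + 1) epsD (2 * i.val + 1)

/-- `ě_j`. -/
def checkE (m : ℕ) (d : Kq) (j : Fin (m + 1 + 1)) : UD (2 * m + 1) epsD :=
  if j.val = 0 then qcomm d (UD.e (2 * m + 1) epsD 2) (UD.e (2 * m + 1) epsD 0)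
  else if j.val = m + 1 then
    qcomm d (UD.e (2 * m + 1) epsD (2 * m + 1)) (UD.e (2 * m + 1) epsD (2 * m - 1))
  else qcomm d (UD.e (2 * m + 1) epsD (2 * j.val)) (UD.e (2 * m + 1) epsD (2 * j.val - 1))

/-- `f̌_j`. -/
def checkF (m : ℕ) (d : Kq) (j : Fin (m + 1 + 1)) : UD (2 * m + 1) epsD :=
  if j.val = 0 then qcomm d⁻¹ (UD.f (2 * m + 1) epsD 0) (UD.f (2 * m + 1) epsD 2)
  else if j.val = m + 1 then
    qcomm d⁻¹ (UD.f (2 * m + 1) epsD (2 * m - 1)) (UD.f (2 * m + 1) epsD (2 * m + 1))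
  else qcomm d⁻¹ (UD.f (2 * m + 1) epsD (2 * j.val - 1)) (UD.f (2 * m + 1) epsD (2 * j.val))

/-- `ǩ_j`. -/
def checkK (m : ℕ) (j : Fin (m + 1 + 1)) : UD (2 * m + 1) epsD :=
  if j.val = 0 then UD.k (2 * m + 1) epsD 0 * UD.k (2 * m + 1) epsD 2
  else if j.val = m + 1 then
    UD.k (2 * m + 1) epsD (2 * m - 1) * UD.k (2 * m + 1) epsD (2 * m + 1)
  else UD.k (2 * m + 1) epsD (2 * j.val - 1) * UD.k (2 * m + 1) epsD (2 * j.val)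

end TypeD

end QuantumD

end

open QuantumD

/-! For an alternating sequence every simple root is isotropic, so every `e_i` squares to zero. The
sums of neighbouring simple roots fall into two families. The sums of the pairs `(2i, 2i+1)` involve
only even coordinates and reproduce the simple roots of `C_m^{(1)}`. The sums of the pairs used for
type `D` involve only odd coordinates and reproduce those of `D_{m+1}^{(1)}`. The bicharacter is `p`
on even coordinates and `-p⁻¹` on odd ones, with `p = q` for the first sequence and `p = q̃` for the
second; these are the two quantum parameters. Thus each type needs only one argument, run for both
values of `p`. Reversing a `c`-commutator inverts `c` and multiplies by `-c`, which accounts for the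
reversed brackets of (3) and (4).

The relations among the `k`'s, and of the `k`'s with the brackets, are bookkeeping with the
bicharacter `g`. A bracket `[e_a, e_b]_c` has the right commutator with its opposite because `c +
c⁻¹ = g + g⁻¹` at the pair (`Triangular.bracket_self`). The same identity makes the `e`- and
`f`-brackets of two different pairs commute when the pairs share a letter
(`Triangular.bracket_fork`).

The substance is in the Serre relations. Write `L`, `R` for left and right multiplication by `E = ab
+ t ba`, where `a² = b² = 0`. The cubic Serre relation on `u` is `(L - tR)(L - t⁻¹R)u = 0`. One
factor turns `u` into `aW + tWa` with `W = ub - t⁻¹bu`. Since `aE = tEa`, and since the quartic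
defining relation says exactly that `E` commutes with `W`, the second factor kills this element
(`Quartic.cubicSerre`). At a fork the same scheme works with `E = ab + t² ba` and gives the
parameter `t²` of a long root (`Fork.cubicSerre`). If two elements satisfy the cubic relation, their
product satisfies the quartic one (`CubicSerre.mul`), which settles the double bonds of type `C`.
The two type `D` brackets at a fork commute by `Fork.commute_prongs`. -/

namespace QuantumD

/-! ### Serre relations for `q`-commutators of two square-zero elements. -/

section Straightening

variable {K A : Type*} [Field K] [Ring A] [Algebra K A]

/-- The quartic relation among `u`, `a` and a middle letter `b`. -/
def Quartic (s : K) (b u a : A) : Prop :=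
  b * u * b * a - b * a * b * u + s • (b * u * a * b) - u * b * a * b + a * b * u * b = 0

/-- The cubic relation at a fork whose prongs are `a`, `b` and whose handle is `u`. -/
def Fork (s : K) (a b u : A) : Prop :=
  a * b * u - b * a * u + s • (b * u * a - a * u * b) + u * a * b - u * b * a = 0

/-- The cubic quantum Serre relation with middle coefficient `s`. -/
def CubicSerre (s : K) (E z : A) : Prop :=
  E * E * z - s • (E * z * E) + z * E * E = 0

/-- The quartic quantum Serre relation with middle coefficient `s`. -/
def QuarticSerre (s : K) (E z : A) : Prop :=
  E * E * E * z - s • (E * E * z * E) + s • (E * z * E * E) - z * E * E * E = 0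

theorem Quartic.symm {s : K} {b u a : A} (hua : u * a = a * u) (h : Quartic s b u a) :
    Quartic (-s) b a u := by
  unfold Quartic at *
  have h2 : b * u * a * b = b * a * u * b := by rw [mul_assoc b u a, hua, ← mul_assoc]
  rw [h2] at h
  linear_combination (norm := module) -h

/-- With `L`, `R` the left and right multiplication by `E`, the Serre expression factors as `(L -
t⁻¹R)(L - tR)u`, and the element inside the hypothesis is `-t⁻¹(L - tR)u`. -/
theorem cubicSerre_of_straighten {t : K} (ht : t ≠ 0) {E u : A}
    (h : E * (u * E - t⁻¹ • (E * u)) = t⁻¹ • ((u * E - t⁻¹ • (E * u)) * E)) :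
    CubicSerre (t + t⁻¹) E u := by
  unfold CubicSerre
  simp only [mul_sub, sub_mul, mul_smul_comm, smul_mul_assoc, smul_sub, smul_smul,
    ← mul_assoc] at h
  linear_combination (norm := skip) (-t) • h
  match_scalars <;> field_simp <;> ring

/-- Both sides reduce to `t aba`. -/
theorem straighten_left {t : K} {a b : A} (ha : a * a = 0) :
    a * (a * b + t • (b * a)) = t • ((a * b + t • (b * a)) * a) := by
  simp only [mul_add, add_mul, mul_smul_comm, smul_mul_assoc, mul_assoc, ha, mul_zero]
  simp only [← mul_assoc, ha, zero_mul]
  module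

theorem straighten_sum {t r w : K} (ht : t ≠ 0) {E a W : A} (ha : a * E = t • (E * a))
    (hW : E * W = W * E) :
    E * (r • (a * W + w • (W * a))) = t⁻¹ • ((r • (a * W + w • (W * a))) * E) := by
  have h1 : E * a = t⁻¹ • (a * E) := by rw [ha, smul_smul, inv_mul_cancel₀ ht, one_smul]
  have h2 : E * (a * W) = t⁻¹ • (a * W * E) := by
    rw [← mul_assoc, h1, smul_mul_assoc, mul_assoc, hW, mul_assoc]
  have h3 : E * (W * a) = t⁻¹ • (W * a * E) := by
    rw [← mul_assoc, hW, mul_assoc, h1, mul_smul_comm, mul_assoc]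
  simp only [mul_smul_comm, mul_add, h2, h3, smul_mul_assoc, add_mul]
  module

/-- Once `b² = 0` and `ua = au` are used, the difference of the two sides is the left side of the
quartic relation itself; the coefficient `t + t⁻¹` collects the terms `baub` and `buab`. -/
theorem Quartic.commute {t : K} (ht : t ≠ 0) {a b u : A} (hb : b * b = 0) (hua : u * a = a * u)
    (h : Quartic (t + t⁻¹) b u a) :
    (a * b + t • (b * a)) * (u * b - t⁻¹ • (b * u)) =
      (u * b - t⁻¹ • (b * u)) * (a * b + t • (b * a)) := by
  have hb' : ∀ z, b * (b * z) = 0 := fun z => by rw [← mul_assoc, hb, zero_mul]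
  have hua' : ∀ z, u * (a * z) = a * (u * z) := fun z => by rw [← mul_assoc, hua, mul_assoc]
  unfold Quartic at h
  simp only [mul_add, add_mul, mul_sub, sub_mul, mul_smul_comm, smul_mul_assoc, mul_assoc,
    hb', hua', mul_zero] at h ⊢
  linear_combination (norm := skip) h
  match_scalars <;> field_simp <;> ring

/-- If `[a, b]_{-t}` meets a letter `u` only through `b`, then it satisfies a cubic Serre relation
with `u`. -/
theorem Quartic.cubicSerre {t : K} (ht : t ≠ 0) {a b u : A} (ha : a * a = 0) (hb : b * b = 0)
    (hua : u * a = a * u) (h : Quartic (t + t⁻¹) b u a) :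
    CubicSerre (t + t⁻¹) (a * b + t • (b * a)) u := by
  apply cubicSerre_of_straighten ht
  have key : u * (a * b + t • (b * a)) - t⁻¹ • ((a * b + t • (b * a)) * u) =
      (1 : K) • (a * (u * b - t⁻¹ • (b * u)) + t • ((u * b - t⁻¹ • (b * u)) * a)) := by
    have h1 : u * (a * b) = a * (u * b) := by rw [← mul_assoc, hua, mul_assoc]
    simp only [mul_add, add_mul, mul_sub, sub_mul, mul_smul_comm, smul_mul_assoc, mul_assoc, h1,
      hua]
    match_scalars <;> field_simp
  rw [key]
  exact straighten_sum ht (straighten_left ha) (h.commute ht hb hua)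

/-- The fork relation is cubic and the claim quartic, so it is multiplied by `b` on each side; `b² =
0` removes part of the terms. The square `t²` arises as `t(t + t⁻¹) - 1`. -/
theorem Fork.commute {t : K} (ht : t ≠ 0) {a b u : A} (hb : b * b = 0)
    (h : Fork (t + t⁻¹) a b u) :
    (a * b + t ^ 2 • (b * a)) * (u * b - t⁻¹ • (b * u)) =
      (u * b - t⁻¹ • (b * u)) * (a * b + t ^ 2 • (b * a)) := by
  have hb' : ∀ z, b * (b * z) = 0 := fun z => by rw [← mul_assoc, hb, zero_mul]
  unfold Fork at h
  have h1 := congrArg (· * b) h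
  have h2 := congrArg (b * ·) h
  simp only [mul_add, add_mul, mul_sub, sub_mul, mul_smul_comm, smul_mul_assoc, mul_assoc, hb,
    hb', mul_zero, smul_zero, zero_mul, smul_sub] at h1 h2 ⊢
  linear_combination (norm := skip) h1 - t • h2
  match_scalars <;> field_simp <;> ring

theorem Fork.cubicSerre {t : K} (ht : t ≠ 0) {a b u : A} (ha : a * a = 0) (hb : b * b = 0)
    (h : Fork (t + t⁻¹) a b u) :
    CubicSerre (t ^ 2 + (t ^ 2)⁻¹) (a * b + t ^ 2 • (b * a)) u := by
  have ht2 : t ^ 2 ≠ 0 := pow_ne_zero 2 ht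
  apply cubicSerre_of_straighten ht2
  -- This is the fork relation rewritten, and the counterpart of the decomposition that `ua = au`
  -- gives in the quartic case.
  have key : u * (a * b + t ^ 2 • (b * a)) - (t ^ 2)⁻¹ • ((a * b + t ^ 2 • (b * a)) * u) =
      (t + t⁻¹) • (a * (u * b - t⁻¹ • (b * u)) + t • ((u * b - t⁻¹ • (b * u)) * a)) := by
    unfold Fork at h
    simp only [mul_add, add_mul, mul_sub, sub_mul, mul_smul_comm, smul_mul_assoc, mul_assoc]
      at h ⊢
    linear_combination (norm := skip) h
    match_scalars <;> field_simp <;> ring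
  rw [key]
  exact straighten_sum ht2 (straighten_left ha) (h.commute ht hb)

/-- Multiplying the fork relation by the handle `u` on either side and using `u² = 0` gives two
quartic relations; a combination of them divided by `t + t⁻¹` is the commutator. -/
theorem Fork.commute_prongs {t : K} (ht : t ≠ 0) (hs : t + t⁻¹ ≠ 0) {a b u : A} (hu : u * u = 0)
    (h : Fork (t + t⁻¹) a b u) :
    (a * u - t • (u * a)) * (b * u - t • (u * b)) =
      (b * u - t • (u * b)) * (a * u - t • (u * a)) := by
  have hu' : ∀ z, u * (u * z) = 0 := fun z => by rw [← mul_assoc, hu, zero_mul]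
  unfold Fork at h
  have h1 := congrArg (· * u) h
  have h2 := congrArg (u * ·) h
  simp only [mul_add, add_mul, mul_sub, sub_mul, mul_smul_comm, smul_mul_assoc, mul_assoc, hu,
    hu', mul_zero, smul_zero, zero_mul, smul_sub] at h1 h2 ⊢
  have hs' : t ^ 2 + 1 ≠ 0 := by
    intro h0; apply hs; field_simp; simpa using h0
  linear_combination (norm := skip) (-(t + t⁻¹)⁻¹) • h1 - (t ^ 2 * (t + t⁻¹)⁻¹) • h2
  match_scalars <;> field_simp <;> ring

theorem CubicSerre.mul_right {s : K} {E u v : A} (h : CubicSerre s E u) (hv : v * E = E * v) :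
    CubicSerre s E (u * v) := by
  unfold CubicSerre at *
  have h1 := congrArg (· * v) h
  simp only [add_mul, sub_mul, smul_mul_assoc, mul_assoc, hv, zero_mul] at h1 ⊢
  exact h1

theorem CubicSerre.mul_left {s : K} {E u v : A} (h : CubicSerre s E u) (hv : v * E = E * v) :
    CubicSerre s E (v * u) := by
  unfold CubicSerre at *
  have h1 := congrArg (v * ·) h
  have hv' : ∀ z, v * (E * z) = E * (v * z) := fun z => by rw [← mul_assoc, hv, mul_assoc]
  simp only [mul_add, mul_sub, mul_smul_comm, mul_assoc, hv', mul_zero] at h1 ⊢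
  exact h1

theorem CubicSerre.sub_smul {s r : K} {E y z : A} (hy : CubicSerre s E y)
    (hz : CubicSerre s E z) : CubicSerre s E (y - r • z) := by
  unfold CubicSerre at *
  simp only [mul_sub, sub_mul, mul_smul_comm, smul_mul_assoc]
  linear_combination (norm := module) hy - r • hz

theorem CubicSerre.smul {s : K} {E z : A} (h : CubicSerre s E z) (r r' : K) :
    CubicSerre s (r • E) (r' • z) := by
  unfold CubicSerre at *
  simp only [mul_smul_comm, smul_mul_assoc]
  linear_combination (norm := module) (r * r * r') • h

/-- The cubic relation says that moving `E` past `y` or `z` has "eigenvalues" `t` and `t⁻¹`. For the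
product the eigenvalues multiply to `t²`, `1`, `t⁻²`, and the quartic relation is `(L - t²R)(L -
R)(L - t⁻²R)(yz) = 0`. -/
theorem CubicSerre.mul {t : K} (ht : t ≠ 0) {E y z : A} (hy : CubicSerre (t + t⁻¹) E y)
    (hz : CubicSerre (t + t⁻¹) E z) : QuarticSerre (t ^ 2 + 1 + (t ^ 2)⁻¹) E (y * z) := by
  unfold CubicSerre at hy hz
  unfold QuarticSerre
  have y1 := congrArg (E * · * z) hy
  have y2 := congrArg (· * z * E) hy
  have y3 := congrArg (· * E * z) hy
  have z1 := congrArg (E * y * ·) hz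
  have z2 := congrArg (y * · * E) hz
  have z3 := congrArg (y * E * ·) hz
  simp only [mul_add, add_mul, mul_sub, sub_mul, mul_smul_comm, smul_mul_assoc, zero_mul,
    mul_zero, ← mul_assoc] at y1 y2 y3 z1 z2 z3 ⊢
  -- Powers of `E` to the left of `y`, between `y` and `z`, and to the right of `z` behave as
  -- commuting variables `X`, `Y`, `Z`. The coefficients write `(X - t²Z)(X - Z)(X - t⁻²Z)` in the
  -- ideal generated by `(X - tY)(X - t⁻¹Y)` and `(Y - tZ)(Y - t⁻¹Z)`.
  linear_combination (norm := skip) y1 - (t ^ 2 + t⁻¹ * (t + t⁻¹)) • y2 + (t + t⁻¹) • y3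
    + (t⁻¹ ^ 2 + t * (t + t⁻¹)) • z1 - z2 - (t + t⁻¹) • z3
  match_scalars <;> field_simp <;> ring

theorem QuarticSerre.sub_smul {s r : K} {E y z : A} (hy : QuarticSerre s E y)
    (hz : QuarticSerre s E z) : QuarticSerre s E (y - r • z) := by
  unfold QuarticSerre at *
  simp only [mul_sub, sub_mul, mul_smul_comm, smul_mul_assoc]
  linear_combination (norm := module) hy - r • hz

theorem QuarticSerre.smul {s : K} {E z : A} (h : QuarticSerre s E z) (r r' : K) :
    QuarticSerre s (r • E) (r' • z) := by
  unfold QuarticSerre at *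
  simp only [mul_smul_comm, smul_mul_assoc]
  linear_combination (norm := module) (r * r * r * r') • h

theorem Fork.symm {s : K} {a b u : A} (h : Fork s a b u) : Fork s b a u := by
  unfold Fork at *
  linear_combination (norm := module) -h

theorem bracket_swap {c : K} (hc : c ≠ 0) (a b : A) :
    b * a - c • (a * b) = (-c) • (a * b - c⁻¹ • (b * a)) := by
  match_scalars <;> field_simp

/-- The coefficient `p + p⁻¹` is invariant under `p ↦ p⁻¹`, so both choices of `c` come from the
same statement with `t = p` or `t = p⁻¹`. -/
theorem Quartic.bracket {p c : K} (hp : p ≠ 0) (hc : c = -p ∨ c = -p⁻¹) {a b u : A}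
    (ha : a * a = 0) (hb : b * b = 0) (hua : u * a = a * u) (h : Quartic (p + p⁻¹) b u a) :
    CubicSerre (p + p⁻¹) (a * b - c • (b * a)) u := by
  rcases hc with rfl | rfl
  · rw [neg_smul, sub_neg_eq_add]
    exact h.cubicSerre hp ha hb hua
  · rw [neg_smul, sub_neg_eq_add]
    have e : p + p⁻¹ = p⁻¹ + p⁻¹⁻¹ := by rw [inv_inv, add_comm]
    rw [e] at h ⊢
    exact h.cubicSerre (inv_ne_zero hp) ha hb hua

theorem neg_inv_or {p c : K} (hc : c = -p ∨ c = -p⁻¹) : c⁻¹ = -p ∨ c⁻¹ = -p⁻¹ := by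
  rcases hc with rfl | rfl
  · right; rw [inv_neg]
  · left; rw [inv_neg, inv_inv]

theorem ne_zero_of_neg_inv_or {p c : K} (hp : p ≠ 0) (hc : c = -p ∨ c = -p⁻¹) : c ≠ 0 := by
  rcases hc with rfl | rfl
  · exact neg_ne_zero.2 hp
  · exact neg_ne_zero.2 (inv_ne_zero hp)

theorem Quartic.bracket' {p c : K} (hp : p ≠ 0) (hc : c = -p ∨ c = -p⁻¹) {a b u : A}
    (ha : a * a = 0) (hb : b * b = 0) (hua : u * a = a * u) (h : Quartic (p + p⁻¹) b u a) :
    CubicSerre (p + p⁻¹) (b * a - c • (a * b)) u := by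
  rw [bracket_swap (ne_zero_of_neg_inv_or hp hc)]
  simpa using (h.bracket hp (neg_inv_or hc) ha hb hua).smul (-c) 1

theorem Fork.bracket {p c : K} (hp : p ≠ 0) (hc : c = -p ^ 2 ∨ c = -(p ^ 2)⁻¹) {a b u : A}
    (ha : a * a = 0) (hb : b * b = 0) (h : Fork (p + p⁻¹) a b u) :
    CubicSerre (p ^ 2 + (p ^ 2)⁻¹) (a * b - c • (b * a)) u := by
  rcases hc with rfl | rfl
  · rw [neg_smul, sub_neg_eq_add]
    exact h.cubicSerre hp ha hb
  · rw [neg_smul, sub_neg_eq_add]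
    have e : p + p⁻¹ = p⁻¹ + p⁻¹⁻¹ := by rw [inv_inv, add_comm]
    rw [e] at h
    have := h.cubicSerre (inv_ne_zero hp) ha hb
    rwa [inv_pow, inv_inv, add_comm] at this

end Straightening

/-! ### Commutators of `e`-brackets with `f`-brackets. -/

section Triangular

variable {K A : Type*} [Field K] [Ring A] [Algebra K A]

/-- The relations between the three parts of a quantum group with generators indexed by
`0, …, n`: here `k' i` is the inverse of `k i`, the bicharacter is `g`, and `κ` is the common
normalization of the commutators `[e i, f i]`. -/
structure Triangular (n : ℕ) (κ : K) (g : ℕ → ℕ → K) (e f k k' : ℕ → A) : Prop where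
  mul_inv : ∀ i, i ≤ n → k i * k' i = 1
  inv_mul : ∀ i, i ≤ n → k' i * k i = 1
  k_comm : ∀ i j, i ≤ n → j ≤ n → k i * k j = k j * k i
  ne_zero : ∀ i j, g i j ≠ 0
  k_e : ∀ i j, i ≤ n → j ≤ n → k i * e j = g i j • (e j * k i)
  k_f : ∀ i j, i ≤ n → j ≤ n → k i * f j = (g i j)⁻¹ • (f j * k i)
  e_f : ∀ i, i ≤ n → e i * f i = f i * e i + κ • k i - κ • k' i
  e_f_ne : ∀ i j, i ≤ n → j ≤ n → i ≠ j → e i * f j = f j * e i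

variable {n : ℕ} {κ : K} {g : ℕ → ℕ → K} {e f k k' : ℕ → A}

theorem inv_mul_eq_smul {c : K} (hc : c ≠ 0) {x y y' : A} (h1 : y * y' = 1) (h2 : y' * y = 1)
    (h : y * x = c • (x * y)) : y' * x = c⁻¹ • (x * y') := by
  have h3 : y' * (y * x) * y' = x * y' := by rw [← mul_assoc, h2, one_mul]
  rw [h, mul_smul_comm, smul_mul_assoc, mul_assoc, mul_assoc, h1, mul_one] at h3
  rw [← h3, smul_smul, inv_mul_cancel₀ hc, one_smul]

namespace Triangular

theorem inv_e (T : Triangular n κ g e f k k') {i j : ℕ} (hi : i ≤ n) (hj : j ≤ n) :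
    k' i * e j = (g i j)⁻¹ • (e j * k' i) :=
  inv_mul_eq_smul (T.ne_zero i j) (T.mul_inv i hi) (T.inv_mul i hi) (T.k_e i j hi hj)

theorem inv_f (T : Triangular n κ g e f k k') {i j : ℕ} (hi : i ≤ n) (hj : j ≤ n) :
    k' i * f j = g i j • (f j * k' i) := by
  simpa using inv_mul_eq_smul (inv_ne_zero (T.ne_zero i j)) (T.mul_inv i hi) (T.inv_mul i hi)
    (T.k_f i j hi hj)

theorem inv_k (T : Triangular n κ g e f k k') {i j : ℕ} (hi : i ≤ n) (hj : j ≤ n) :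
    k' i * k j = k j * k' i := by
  simpa using inv_mul_eq_smul (one_ne_zero (α := K)) (T.mul_inv i hi) (T.inv_mul i hi)
    (x := k j) (by rw [one_smul, T.k_comm i j hi hj])

theorem inv_inv (T : Triangular n κ g e f k k') {i j : ℕ} (hi : i ≤ n) (hj : j ≤ n) :
    k' i * k' j = k' j * k' i := by
  simpa using inv_mul_eq_smul (one_ne_zero (α := K)) (T.mul_inv i hi) (T.inv_mul i hi)
    (x := k' j) (by rw [one_smul, T.inv_k hj hi])

/-- The commutator of two opposite `q`-commutators. -/
theorem bracket_self (T : Triangular n κ g e f k k') {a b : ℕ} (ha : a ≤ n) (hb : b ≤ n)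
    (hab : a ≠ b) (hsymm : g b a = g a b) {c : K} (hc : c = g a b ∨ c = (g a b)⁻¹) :
    (e a * e b - c • (e b * e a)) * (f b * f a - c⁻¹ • (f a * f b)) -
      (f b * f a - c⁻¹ • (f a * f b)) * (e a * e b - c • (e b * e a)) =
      (κ ^ 2 * ((g a b)⁻¹ - g a b)) • (k a * k b - k' a * k' b) := by
  have hg := T.ne_zero a b
  have r1 := T.e_f a ha
  have r2 := T.e_f b hb
  have r3 := T.e_f_ne a b ha hb hab
  have r4 := T.e_f_ne b a hb ha hab.symm
  have r5 := T.k_e a b ha hb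
  have r6 := T.k_e b a hb ha
  have r7 := T.k_f a b ha hb
  have r8 := T.k_f b a hb ha
  have s5 := T.inv_e ha hb
  have s6 := T.inv_e hb ha
  have s7 := T.inv_f ha hb
  have s8 := T.inv_f hb ha
  have t1 := T.k_comm b a hb ha
  have t2 := T.inv_k ha hb
  have t3 := T.inv_k hb ha
  have t4 := T.inv_inv hb ha
  rw [hsymm] at r6 r8 s6 s8
  have r1' : ∀ z, e a * (f a * z) = f a * (e a * z) + κ • (k a * z) - κ • (k' a * z) :=
    fun z => by rw [← mul_assoc, r1]; simp only [add_mul, sub_mul, smul_mul_assoc, mul_assoc]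
  have r2' : ∀ z, e b * (f b * z) = f b * (e b * z) + κ • (k b * z) - κ • (k' b * z) :=
    fun z => by rw [← mul_assoc, r2]; simp only [add_mul, sub_mul, smul_mul_assoc, mul_assoc]
  have r3' : ∀ z, e a * (f b * z) = f b * (e a * z) := fun z => by
    rw [← mul_assoc, r3, mul_assoc]
  have r4' : ∀ z, e b * (f a * z) = f a * (e b * z) := fun z => by
    rw [← mul_assoc, r4, mul_assoc]
  have r7' : ∀ z, k a * (f b * z) = (g a b)⁻¹ • (f b * (k a * z)) := fun z => by
    rw [← mul_assoc, r7, smul_mul_assoc, mul_assoc]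
  have r8' : ∀ z, k b * (f a * z) = (g a b)⁻¹ • (f a * (k b * z)) := fun z => by
    rw [← mul_assoc, r8, smul_mul_assoc, mul_assoc]
  have s7' : ∀ z, k' a * (f b * z) = g a b • (f b * (k' a * z)) := fun z => by
    rw [← mul_assoc, s7, smul_mul_assoc, mul_assoc]
  have s8' : ∀ z, k' b * (f a * z) = g a b • (f a * (k' b * z)) := fun z => by
    rw [← mul_assoc, s8, smul_mul_assoc, mul_assoc]
  simp only [mul_add, mul_sub, sub_mul, mul_smul_comm, smul_mul_assoc, mul_assoc,
    smul_add, smul_sub, r1, r2, r3, r4, r5, r6, r7, r8, s5, s6, s7, s8, t1, t2, t3, t4,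
    r1', r2', r3', r4', r7', r8', s7', s8']
  -- The mixed terms, such as `f_a e_a k_b`, carry the factor `g + g⁻¹ - c - c⁻¹` with `g = g a b`.
  -- It vanishes exactly for `c = g` and `c = g⁻¹`.
  rcases hc with rfl | rfl <;> (match_scalars <;> field_simp <;> ring)

/-- Opposite `q`-commutators that share the letter `u` commute. -/
theorem bracket_fork (T : Triangular n κ g e f k k') {a b u : ℕ} (ha : a ≤ n) (hb : b ≤ n)
    (hu : u ≤ n) (hab : a ≠ b) (hau : a ≠ u) (hbu : b ≠ u) (hsymm : g u a = g a u)
    (hg : g u b = g a u) {c : K} (hc : c = g a u ∨ c = (g a u)⁻¹) :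
    (e a * e u - c • (e u * e a)) * (f u * f b - c⁻¹ • (f b * f u)) =
      (f u * f b - c⁻¹ • (f b * f u)) * (e a * e u - c • (e u * e a)) := by
  have hg0 := T.ne_zero a u
  have r1 := T.e_f u hu
  have r2 := T.e_f_ne a b ha hb hab
  have r3 := T.e_f_ne a u ha hu hau
  have r4 := T.e_f_ne u b hu hb hbu.symm
  have r5 := T.k_e u a hu ha
  have r6 := T.k_f u b hu hb
  have s5 := T.inv_e hu ha
  have s6 := T.inv_f hu hb
  rw [hsymm] at r5 s5
  rw [hg] at r6 s6
  have r1' : ∀ z, e u * (f u * z) = f u * (e u * z) + κ • (k u * z) - κ • (k' u * z) :=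
    fun z => by rw [← mul_assoc, r1]; simp only [add_mul, sub_mul, smul_mul_assoc, mul_assoc]
  have r2' : ∀ z, e a * (f b * z) = f b * (e a * z) := fun z => by
    rw [← mul_assoc, r2, mul_assoc]
  have r3' : ∀ z, e a * (f u * z) = f u * (e a * z) := fun z => by
    rw [← mul_assoc, r3, mul_assoc]
  have r4' : ∀ z, e u * (f b * z) = f b * (e u * z) := fun z => by
    rw [← mul_assoc, r4, mul_assoc]
  have r6' : ∀ z, k u * (f b * z) = (g a u)⁻¹ • (f b * (k u * z)) := fun z => by
    rw [← mul_assoc, r6, smul_mul_assoc, mul_assoc]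
  have s6' : ∀ z, k' u * (f b * z) = g a u • (f b * (k' u * z)) := fun z => by
    rw [← mul_assoc, s6, smul_mul_assoc, mul_assoc]
  simp only [mul_add, mul_sub, sub_mul, mul_smul_comm, smul_mul_assoc, mul_assoc,
    smul_add, smul_sub, r1, r2, r3, r4, r5, r6, s5, s6, r1', r2', r3', r4', r6', s6']
  -- Only the letters with index `u` interact; the resulting terms `f_b e_a k_u` again carry the
  -- factor `g + g⁻¹ - c - c⁻¹`.
  rcases hc with rfl | rfl <;> (match_scalars <;> field_simp <;> ring)

end Triangular

end Triangular

/-! ### Small `q`-integers, explicit Serre expressions, and maps out of Drinfeld–Jimbo algebras. -/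

theorem qint_one {p : Kq} (h1 : p ^ 2 ≠ 1) (h0 : p ≠ 0) : qint p 1 = 1 := by
  have h : p - p⁻¹ ≠ 0 := by
    intro h; apply h1; field_simp at h; linear_combination h
  simp [qint, h]

theorem qint_two {p : Kq} (h1 : p ^ 2 ≠ 1) (h0 : p ≠ 0) : qint p 2 = p + p⁻¹ := by
  have h : p - p⁻¹ ≠ 0 := by
    intro h; apply h1; field_simp at h; linear_combination h
  rw [qint, div_eq_iff h]
  ring

theorem qint_three {p : Kq} (h1 : p ^ 2 ≠ 1) (h0 : p ≠ 0) :
    qint p 3 = p ^ 2 + 1 + (p ^ 2)⁻¹ := by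
  have h : p - p⁻¹ ≠ 0 := by
    intro h; apply h1; field_simp at h; linear_combination h
  rw [qint, div_eq_iff h]
  field_simp
  ring

theorem qint_ne_zero {p : Kq} {k : ℕ} (h1 : p ^ 2 ≠ 1) (h0 : p ≠ 0) (hk : p ^ (2 * k) ≠ 1) :
    qint p k ≠ 0 := by
  have h : p - p⁻¹ ≠ 0 := by
    intro h; apply h1; field_simp at h; linear_combination h
  rw [qint, div_ne_zero_iff]
  refine ⟨fun h => hk ?_, h⟩
  have h2 : p ^ k ≠ 0 := pow_ne_zero k h0
  rw [inv_pow] at h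
  field_simp at h
  rw [pow_mul']
  linear_combination h

section Serre

variable {A : Type} [Ring A] [Algebra Kq A]

theorem serre_zero {p : Kq} (h1 : p ^ 2 ≠ 1) (h0 : p ≠ 0) (x y : A) :
    serre p 0 x y = x * y - y * x := by
  simp [serre, Finset.sum_range_succ, qbinom, qfact, qint_one h1 h0, sub_eq_add_neg]

theorem serre_neg_one {p : Kq} (h1 : p ^ 4 ≠ 1) (h0 : p ≠ 0) (x y : A) :
    serre p (-1) x y = x * x * y - (p + p⁻¹) • (x * y * x) + y * x * x := by
  have h2 : p ^ 2 ≠ 1 := fun h => h1 (by linear_combination (p ^ 2 + 1) * h)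
  have h3 := qint_ne_zero (k := 2) h2 h0 h1
  have e : (1 - (-1 : ℤ)).toNat = 2 := rfl
  have b0 : qbinom p 2 0 = 1 := by simp [qbinom, qfact]
  have b1 : qbinom p 2 1 = p + p⁻¹ := by
    simp [qbinom, qfact, qint_one h2 h0, qint_two h2 h0]
  have b2 : qbinom p 2 2 = 1 := by
    simp only [qbinom, qfact, Finset.prod_range_succ, Finset.prod_range_zero, one_mul]
    norm_num [qint_one h2 h0, h3]
  rw [serre, e]
  simp only [Finset.sum_range_succ, Finset.sum_range_zero, zero_add, b0, b1, b2]
  generalize p + p⁻¹ = s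
  simp [pow_two, mul_assoc, sub_eq_add_neg]

theorem serre_neg_two {p : Kq} (h1 : p ^ 4 ≠ 1) (h1' : p ^ 6 ≠ 1) (h0 : p ≠ 0) (x y : A) :
    serre p (-2) x y = x * x * x * y - (p ^ 2 + 1 + (p ^ 2)⁻¹) • (x * x * y * x)
      + (p ^ 2 + 1 + (p ^ 2)⁻¹) • (x * y * x * x) - y * x * x * x := by
  have h2 : p ^ 2 ≠ 1 := fun h => h1 (by linear_combination (p ^ 2 + 1) * h)
  have h3 := qint_ne_zero (k := 2) h2 h0 h1
  have h4 := qint_ne_zero (k := 3) h2 h0 h1'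
  have e : (1 - (-2 : ℤ)).toNat = 3 := rfl
  have b0 : qbinom p 3 0 = 1 := by simp [qbinom, qfact]
  have b1 : qbinom p 3 1 = p ^ 2 + 1 + (p ^ 2)⁻¹ := by
    simp [qbinom, qfact, qint_one h2 h0, qint_three h2 h0]
  have b2 : qbinom p 3 2 = p ^ 2 + 1 + (p ^ 2)⁻¹ := by
    simp only [qbinom, qfact, Finset.prod_range_succ, Finset.prod_range_zero, one_mul]
    norm_num [qint_one h2 h0, h3, qint_three h2 h0]
  have b3 : qbinom p 3 3 = 1 := by
    simp only [qbinom, qfact, Finset.prod_range_succ, Finset.prod_range_zero, one_mul]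
    norm_num [qint_one h2 h0]
    field_simp
  rw [serre, e]
  simp only [Finset.sum_range_succ, Finset.sum_range_zero, zero_add, b0, b1, b2, b3]
  generalize p ^ 2 + 1 + (p ^ 2)⁻¹ = s
  simp [pow_succ, mul_assoc, sub_eq_add_neg]

end Serre

/-- Elements of an algebra that satisfy the Drinfeld–Jimbo relations define a homomorphism. -/
theorem exists_sendsGenerators {J : Type} {a : Matrix J J ℤ} {d : J → ℤ} {p : Kq} {B : Type}
    [Ring B] [Algebra Kq B] {E F K K' : J → B}
    (h1 : ∀ i, K i * K' i = 1) (h2 : ∀ i, K' i * K i = 1) (h3 : ∀ i j, K i * K j = K j * K i)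
    (hE : ∀ i j, K i * E j = (p ^ d i) ^ a i j • (E j * K i))
    (hF : ∀ i j, K i * F j = (p ^ d i) ^ (-a i j) • (F j * K i))
    (hEF : ∀ i, E i * F i - F i * E i = (p ^ d i - (p ^ d i)⁻¹)⁻¹ • (K i - K' i))
    (hEF' : ∀ i j, i ≠ j → E i * F j = F j * E i)
    (hSE : ∀ i j, i ≠ j → serre (p ^ d i) (a i j) (E i) (E j) = 0)
    (hSF : ∀ i j, i ≠ j → serre (p ^ d i) (a i j) (F i) (F j) = 0) :
    ∃ φ : DJ a d p →ₐ[Kq] B, SendsGenerators φ E F K := by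
  let G : DJGen J → B
    | .e i => E i
    | .f i => F i
    | .k i => K i
    | .kinv i => K' i
  let ψ : DJFree J →ₐ[Kq] B := FreeAlgebra.lift Kq G
  have ψe : ∀ i, ψ (DJFree.e i) = E i := fun i => by simp [ψ, DJFree.e, G]
  have ψf : ∀ i, ψ (DJFree.f i) = F i := fun i => by simp [ψ, DJFree.f, G]
  have ψk : ∀ i, ψ (DJFree.k i) = K i := fun i => by simp [ψ, DJFree.k, G]
  have ψk' : ∀ i, ψ (DJFree.kinv i) = K' i := fun i => by simp [ψ, DJFree.kinv, G]
  have ψserre : ∀ (t : Kq) (c : ℤ) (x y : DJFree J),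
      ψ (serre t c x y) = serre t c (ψ x) (ψ y) := fun t c x y => by
    simp [serre, map_sum]
  have hψ : ∀ ⦃x y⦄, DJRel a d p x y → ψ x = ψ y := by
    intro x y h
    induction h with
    | k_kinv i => simp [ψk, ψk', h1]
    | kinv_k i => simp [ψk, ψk', h2]
    | k_k i j => simp [ψk, h3 i j]
    | k_e i j =>
      rw [map_mul, map_mul, map_smul, ψk, ψk', ψe, hE, smul_mul_assoc, mul_assoc, h1, mul_one]
    | k_f i j =>
      rw [map_mul, map_mul, map_smul, ψk, ψk', ψf, hF, smul_mul_assoc, mul_assoc, h1, mul_one]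
    | e_f i => simp [ψk, ψk', ψe, ψf, hEF]
    | e_f_ne i j hij => simp [ψe, ψf, hEF' i j hij]
    | serre_e i j hij => rw [ψserre, ψe, ψe, hSE i j hij, map_zero]
    | serre_f i j hij => rw [ψserre, ψf, ψf, hSF i j hij, map_zero]
  refine ⟨RingQuot.liftAlgHom Kq ⟨ψ, hψ⟩, fun i => ⟨?_, ?_, ?_⟩⟩
  · rw [DJ.e, RingQuot.liftAlgHom_mkAlgHom_apply, ψe]
  · rw [DJ.f, RingQuot.liftAlgHom_mkAlgHom_apply, ψf]
  · rw [DJ.k, RingQuot.liftAlgHom_mkAlgHom_apply, ψk]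

/-! ### Weighted dot products of unit vectors -/

/-- The bilinear form on `ℤ^n` with weight `w i` on the (one-based) `i`-th coordinate. -/
def weightedDot {n : ℕ} (w : ℕ → ℤ) (μ ν : Fin n → ℤ) : ℤ :=
  ∑ j : Fin n, w (j.val + 1) * μ j * ν j

theorem form_eq_weightedDot (n : ℕ) (ε : ℕ → Fin 2) (μ ν : Fin n → ℤ) :
    form n ε μ ν = weightedDot (sgn ε) μ ν := rfl

theorem dotProduct_eq_weightedDot {n : ℕ} (μ ν : Fin n → ℤ) :
    μ ⬝ᵥ ν = weightedDot (fun _ => 1) μ ν := by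
  simp [dotProduct, weightedDot]

section weightedDot

variable {n : ℕ} (w : ℕ → ℤ) (μ μ' ν : Fin n → ℤ)

theorem weightedDot_comm : weightedDot w μ ν = weightedDot w ν μ :=
  Finset.sum_congr rfl fun _ _ => by ring

theorem weightedDot_add_left :
    weightedDot w (μ + μ') ν = weightedDot w μ ν + weightedDot w μ' ν := by
  simp [weightedDot, mul_add, add_mul, Finset.sum_add_distrib]

theorem weightedDot_neg_left : weightedDot w (-μ) ν = -weightedDot w μ ν := by
  simp [weightedDot]

theorem weightedDot_sub_left :
    weightedDot w (μ - μ') ν = weightedDot w μ ν - weightedDot w μ' ν := by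
  rw [sub_eq_add_neg, weightedDot_add_left, weightedDot_neg_left, ← sub_eq_add_neg]

theorem weightedDot_add_right :
    weightedDot w ν (μ + μ') = weightedDot w ν μ + weightedDot w ν μ' := by
  rw [weightedDot_comm, weightedDot_add_left, weightedDot_comm w μ, weightedDot_comm w μ']

theorem weightedDot_neg_right : weightedDot w ν (-μ) = -weightedDot w ν μ := by
  rw [weightedDot_comm, weightedDot_neg_left, weightedDot_comm]

theorem weightedDot_sub_right :
    weightedDot w ν (μ - μ') = weightedDot w ν μ - weightedDot w ν μ' := by
  rw [sub_eq_add_neg, weightedDot_add_right, weightedDot_neg_right, ← sub_eq_add_neg]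

theorem weightedDot_smul_left (c : ℤ) : weightedDot w (c • μ) ν = c * weightedDot w μ ν := by
  simp only [weightedDot, Finset.mul_sum, Pi.smul_apply, smul_eq_mul]
  exact Finset.sum_congr rfl fun _ _ => by ring

theorem weightedDot_smul_right (c : ℤ) : weightedDot w ν (c • μ) = c * weightedDot w ν μ := by
  rw [weightedDot_comm, weightedDot_smul_left, weightedDot_comm]

theorem weightedDot_unitVec (a b : ℕ) :
    weightedDot w (unitVec n a) (unitVec n b) = if a = b ∧ 1 ≤ a ∧ a ≤ n then w a else 0 := by
  unfold weightedDot
  split_ifs with h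
  · obtain ⟨rfl, h1, h2⟩ := h
    rw [Finset.sum_eq_single (⟨a - 1, by omega⟩ : Fin n)]
    · simp [unitVec, Nat.sub_add_cancel h1]
    · intro j _ hj
      have : j.val + 1 ≠ a := fun h => hj (Fin.ext (by simp; omega))
      simp [unitVec, this]
    · simp
  · refine Finset.sum_eq_zero fun j _ => ?_
    have := j.isLt
    have h2 : ¬(j.val + 1 = a ∧ j.val + 1 = b) := by omega
    rcases not_and_or.1 h2 with h2 | h2 <;> simp [unitVec, h2]

end weightedDot

/-- The weight supported on the even coordinates. -/
def evenWeight (i : ℕ) : ℤ := if i % 2 = 0 then 1 else 0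

/-- The weight supported on the odd coordinates. -/
def oddWeight (i : ℕ) : ℤ := if i % 2 = 0 then 0 else 1

theorem rootD_zero (n : ℕ) : rootD n 0 = unitVec n 1 + unitVec n 2 := by simp [rootD]

theorem rootD_last {n : ℕ} (hn : n ≠ 0) : rootD n n = -unitVec n n - unitVec n (n - 1) := by
  simp [rootD, hn]

theorem rootD_mid {n i : ℕ} (h0 : i ≠ 0) (hn : i ≠ n) :
    rootD n i = unitVec n (i + 1) - unitVec n i := by
  simp [rootD, h0, hn]

/-! ### Alternating parity sequences -/

/-- The parity sequence `ε` alternates, and `p` is the value of `q_i` at even `i`. -/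
structure IsAlternating (ε : ℕ → Fin 2) (p : Kq) : Prop where
  ne_zero : p ≠ 0
  -- The exponent is a common multiple of `2`, `4`, `6` and `8`, the powers of `p` that must differ
  -- from `1` for the `q`-binomials to be regular; `8` comes from `(p ^ 2) ^ 4` at a long root.
  pow_ne_one : p ^ 24 ≠ 1
  sub_inv : q - q⁻¹ = p - p⁻¹
  ne_succ : ∀ i, ε i ≠ ε (i + 1)
  sgn_succ : ∀ i, sgn ε (i + 1) = -sgn ε i
  qi_eq : ∀ i, qi ε i = if i % 2 = 0 then p else -p⁻¹
  stwo_eq : ∀ i, stwo ε i = if i % 2 = 0 then p + p⁻¹ else -(p + p⁻¹)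

theorem neg_inv_inv_neg {K : Type*} [Field K] (a : K) : (-a⁻¹)⁻¹ = -a := by
  rw [inv_neg, inv_inv]

theorem inv_qt : qt⁻¹ = -q := neg_inv_inv_neg q

theorem q_ne_zero : q ≠ 0 := pow_ne_zero 2 RatFunc.X_ne_zero

theorem q_pow_ne_one {k : ℕ} (hk : k ≠ 0) : q ^ k ≠ 1 := by
  intro h
  rw [q, ← pow_mul, ← RatFunc.algebraMap_X, ← map_pow, ← map_one (algebraMap (Polynomial ℂ) _)]
    at h
  have h2 := congrArg Polynomial.natDegree (RatFunc.algebraMap_injective ℂ h)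
  rw [Polynomial.natDegree_X_pow, Polynomial.natDegree_one] at h2
  omega

theorem isAlternating_epsC : IsAlternating epsC q where
  ne_zero := q_ne_zero
  pow_ne_one := q_pow_ne_one (by norm_num)
  sub_inv := rfl
  ne_succ i := by unfold epsC; split_ifs <;> first | decide | omega
  sgn_succ i := by unfold sgn epsC; split_ifs <;> first | decide | omega
  qi_eq i := by
    unfold qi epsC
    rcases Nat.mod_two_eq_zero_or_one i with h | h <;> simp [h, qt]
  stwo_eq i := by
    unfold stwo sgn epsC
    rw [qint_two (q_pow_ne_one (by norm_num)) q_ne_zero]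
    rcases Nat.mod_two_eq_zero_or_one i with h | h <;> simp [h]

theorem isAlternating_epsD : IsAlternating epsD qt where
  ne_zero := neg_ne_zero.2 (inv_ne_zero q_ne_zero)
  pow_ne_one := by
    rw [qt, Even.neg_pow (by decide), inv_pow]
    exact inv_ne_one.2 (q_pow_ne_one (by norm_num))
  sub_inv := by rw [inv_qt, qt]; ring
  ne_succ i := by unfold epsD; split_ifs <;> first | decide | omega
  sgn_succ i := by unfold sgn epsD; split_ifs <;> first | decide | omega
  qi_eq i := by
    unfold qi epsD
    rw [inv_qt]
    rcases Nat.mod_two_eq_zero_or_one i with h | h <;> simp [h]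
  stwo_eq i := by
    unfold stwo sgn epsD
    rw [qint_two (q_pow_ne_one (by norm_num)) q_ne_zero, inv_qt]
    rcases Nat.mod_two_eq_zero_or_one i with h | h <;> simp [h, qt]

section qform

variable {n : ℕ} {ε : ℕ → Fin 2} {p : Kq}

theorem qi_ne_zero (ε : ℕ → Fin 2) (i : ℕ) : qi ε i ≠ 0 := by
  unfold qi
  split_ifs
  · exact q_ne_zero
  · exact neg_ne_zero.2 (inv_ne_zero q_ne_zero)

theorem vv_ne_zero : vv ≠ 0 :=
  mul_ne_zero (by simp) RatFunc.X_ne_zero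

theorem qform_ne_zero (μ ν : Lat n) : qform n ε μ ν ≠ 0 :=
  mul_ne_zero (zpow_ne_zero _ vv_ne_zero)
    (Finset.prod_ne_zero_iff.2 fun _ _ => zpow_ne_zero _ (qi_ne_zero _ _))

theorem prod_zpow_eq_zpow_sum {K ι : Type*} [Field K] {a : K} (ha : a ≠ 0) (s : Finset ι)
    (f : ι → ℤ) : ∏ i ∈ s, a ^ f i = a ^ ∑ i ∈ s, f i := by
  classical
  induction s using Finset.induction_on with
  | empty => simp
  | insert i s hi ih => rw [Finset.prod_insert hi, Finset.sum_insert hi, zpow_add₀ ha, ih]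

/-- Simple roots have no `Λ`-component, so the power of `𝐯` is trivial and the product splits by the
parity of the coordinate. -/
theorem IsAlternating.qform_rootP (H : IsAlternating ε p) (i j : ℕ) :
    qform n ε (rootP n i) (rootP n j) =
      p ^ weightedDot evenWeight (rootD n i) (rootD n j) *
        (-p⁻¹) ^ weightedDot oddWeight (rootD n i) (rootD n j) := by
  have h0 := H.ne_zero
  have h1 : -p⁻¹ ≠ 0 := neg_ne_zero.2 (inv_ne_zero h0)
  rw [weightedDot, weightedDot, ← prod_zpow_eq_zpow_sum h0, ← prod_zpow_eq_zpow_sum h1,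
    ← Finset.prod_mul_distrib]
  simp only [qform, rootP, zero_mul, add_zero, Finset.sum_const_zero, zpow_zero, one_mul]
  refine Finset.prod_congr rfl fun k _ => ?_
  rw [H.qi_eq]
  unfold evenWeight oddWeight
  split_ifs <;> simp

theorem qform_comm (μ ν : Lat n) : qform n ε μ ν = qform n ε ν μ := by
  unfold qform
  congr 1
  · congr 1
    exact Finset.sum_congr rfl fun _ _ => by ring
  · exact Finset.prod_congr rfl fun _ _ => by rw [mul_comm]

end qform

/-! ### The relations of `𝓤_D(ε)` -/

section UD

variable {n : ℕ} {ε : ℕ → Fin 2}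

theorem UD.mk_eq {x y : DFree n} (h : DRel n ε x y) :
    RingQuot.mkAlgHom Kq (DRel n ε) x = RingQuot.mkAlgHom Kq (DRel n ε) y :=
  RingQuot.mkAlgHom_rel Kq h

/-- The inverse of `k_i`. -/
noncomputable def UD.kInv (n : ℕ) (ε : ℕ → Fin 2) (i : ℕ) : UD n ε :=
  RingQuot.mkAlgHom Kq (DRel n ε) (DFree.k n (-rootP n i))

theorem UD.mk_k_add (μ ν : Lat n) : RingQuot.mkAlgHom Kq (DRel n ε) (DFree.k n (μ + ν)) =
    RingQuot.mkAlgHom Kq (DRel n ε) (DFree.k n μ) *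
      RingQuot.mkAlgHom Kq (DRel n ε) (DFree.k n ν) := by
  rw [UD.mk_eq (DRel.k_add μ ν), map_mul]

theorem UD.mk_k_zero : RingQuot.mkAlgHom Kq (DRel n ε) (DFree.k n 0) = 1 := by
  rw [UD.mk_eq DRel.k_zero, map_one]

theorem UD.kInv_mul_k (i : ℕ) : UD.kInv n ε i * UD.k n ε i = 1 := by
  rw [UD.kInv, UD.k, ← UD.mk_k_add, neg_add_cancel, UD.mk_k_zero]

/-- Only the `k_μ` with `μ = ±α_i` are needed for the images of the generators; the rest of `P`
plays no role. -/
theorem UD.triangular : Triangular n (q - q⁻¹)⁻¹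
    (fun i j => qform n ε (rootP n i) (rootP n j))
    (UD.e n ε) (UD.f n ε) (UD.k n ε) (UD.kInv n ε) where
  mul_inv i _ := by rw [UD.kInv, UD.k, ← UD.mk_k_add, add_neg_cancel, UD.mk_k_zero]
  inv_mul i _ := UD.kInv_mul_k i
  k_comm i j _ _ := by rw [UD.k, UD.k, ← UD.mk_k_add, add_comm, UD.mk_k_add]
  ne_zero i j := qform_ne_zero _ _
  k_e i j _ hj := by
    have h := UD.mk_eq (DRel.k_e (ε := ε) (rootP n i) j hj)
    rw [map_mul, map_mul, map_smul] at h
    change UD.k n ε i * UD.e n ε j * UD.kInv n ε i = _ • UD.e n ε j at h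
    rw [← smul_mul_assoc, ← h, mul_assoc _ (UD.kInv n ε i), UD.kInv_mul_k, mul_one]
  k_f i j _ hj := by
    have h := UD.mk_eq (DRel.k_f (ε := ε) (rootP n i) j hj)
    rw [map_mul, map_mul, map_smul] at h
    change UD.k n ε i * UD.f n ε j * UD.kInv n ε i = _ • UD.f n ε j at h
    rw [← smul_mul_assoc, ← h, mul_assoc _ (UD.kInv n ε i), UD.kInv_mul_k, mul_one]
  e_f i hi := by
    have h := UD.mk_eq (DRel.e_f (ε := ε) i hi)
    rw [map_sub, map_mul, map_mul, map_smul, map_sub] at h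
    change UD.e n ε i * UD.f n ε i - UD.f n ε i * UD.e n ε i =
      _ • (UD.k n ε i - UD.kInv n ε i) at h
    rw [add_sub_assoc, ← smul_sub (q - q⁻¹)⁻¹ (UD.k n ε i), ← h]
    abel
  e_f_ne i j hi hj hij := by
    have h := UD.mk_eq (DRel.e_f_ne (ε := ε) i j hi hj hij)
    rw [map_sub, map_mul, map_mul, map_zero] at h
    exact sub_eq_zero.1 h

/-- The half relations are imposed on letters of the free algebra; being natural under algebra
homomorphisms, they can be used directly in the quotient. -/
theorem HalfRel.exists_preimage {A B : Type} [Ring A] [Algebra Kq A] [Ring B] [Algebra Kq B]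
    (φ : A →ₐ[Kq] B) {x : ℕ → A} {r : B} (h : HalfRel n ε (fun i => φ (x i)) r) :
    ∃ r₀, HalfRel n ε x r₀ ∧ φ r₀ = r := by
  cases h with
  | odd_sq i hi h => exact ⟨_, .odd_sq i hi h, by simp⟩
  | comm i j hi hj h => exact ⟨_, .comm i j hi hj h, by simp⟩
  | cubic_0_2 h => exact ⟨_, .cubic_0_2 h, by simp⟩
  | cubic_2_0 h => exact ⟨_, .cubic_2_0 h, by simp⟩
  | cubic i j hi hj hij h => exact ⟨_, .cubic i j hi hj hij h, by simp⟩
  | cubic_tail h => exact ⟨_, .cubic_tail h, by simp⟩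
  | cubic_tail' h => exact ⟨_, .cubic_tail' h, by simp⟩
  | head_fork h => exact ⟨_, .head_fork h, by simp⟩
  | head_quartic h => exact ⟨_, .head_quartic h, by simp⟩
  | quartic i hi h => exact ⟨_, .quartic i hi h, by simp⟩
  | tail_quartic h => exact ⟨_, .tail_quartic h, by simp⟩
  | tail_fork h => exact ⟨_, .tail_fork h, by simp⟩

theorem UD.halfRel_e {r : UD n ε} (h : HalfRel n ε (UD.e n ε) r) : r = 0 := by
  obtain ⟨r₀, h', rfl⟩ := HalfRel.exists_preimage (RingQuot.mkAlgHom Kq (DRel n ε)) h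
  rw [UD.mk_eq (DRel.half_e r₀ h'), map_zero]

theorem UD.halfRel_f {r : UD n ε} (h : HalfRel n ε (UD.f n ε) r) : r = 0 := by
  obtain ⟨r₀, h', rfl⟩ := HalfRel.exists_preimage (RingQuot.mkAlgHom Kq (DRel n ε)) h
  rw [UD.mk_eq (DRel.half_f r₀ h'), map_zero]

end UD

theorem fork_of_rev {K A : Type*} [Field K] [Ring A] [Algebra K A] {s : K} {x y z : A}
    (h : x * z * y - x * y * z + s • (y * x * z - z * x * y) + z * y * x - y * z * x = 0) :
    Fork s z y x := by
  unfold Fork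
  linear_combination (norm := module) h

theorem quartic_of_rev {K A : Type*} [Field K] [Ring A] [Algebra K A] {s : K} {b u a : A}
    (hua : u * a = a * u)
    (h : u * b * a * b - a * b * u * b + -s • (b * a * u * b) - b * u * b * a + b * a * b * u = 0) :
    Quartic s b u a := by
  have e : b * a * u * b = b * u * a * b := by rw [mul_assoc b, ← hua, ← mul_assoc]
  rw [e] at h
  unfold Quartic
  linear_combination (norm := module) -h

/-- The relations of one half of `𝓤_D(ε)` for an alternating sequence `ε` of length
`2 * m + 1`. -/
structure HalfSystem {K A : Type*} [Field K] [Ring A] [Algebra K A] (m : ℕ) (s : K)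
    (x : ℕ → A) : Prop where
  sq : ∀ i, i ≤ 2 * m + 1 → x i * x i = 0
  comm : ∀ i j, i + 2 ≤ j → j ≤ 2 * m + 1 → ¬(i = 0 ∧ j = 2) →
    ¬(i = 2 * m - 1 ∧ j = 2 * m + 1) → x i * x j = x j * x i
  head_fork : Fork s (x 0) (x 1) (x 2)
  tail_fork : Fork s (x (2 * m + 1)) (x (2 * m)) (x (2 * m - 1))
  -- The order of the two outer letters is chosen to absorb the sign `(-1)^{ε_i}`, so that all
  -- quartic relations, including those at the ends, have the same coefficient `s`.
  quartic_even : ∀ i, 1 ≤ i → i < m →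
    Quartic s (x (2 * i)) (x (2 * i - 1)) (x (2 * i + 1))
  quartic_odd : ∀ i, 1 ≤ i → i < m →
    Quartic s (x (2 * i + 1)) (x (2 * i + 2)) (x (2 * i))
  head_quartic : Quartic s (x 2) (x 0) (x 3)
  tail_quartic : Quartic s (x (2 * m - 1)) (x (2 * m + 1)) (x (2 * m - 2))

/-- A simple root is supported on two consecutive coordinates with entries `±1`, and their signs in
the form are opposite. -/
theorem IsAlternating.form_self {ε : ℕ → Fin 2} {p : Kq} (H : IsAlternating ε p) {n i : ℕ}
    (hn : 2 ≤ n) (hi : i ≤ n) : form n ε (rootD n i) (rootD n i) = 0 := by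
  rw [form_eq_weightedDot]
  have h1 : sgn ε 2 = -sgn ε 1 := H.sgn_succ 1
  have h2 := H.sgn_succ i
  have h3 := H.sgn_succ (n - 1)
  rw [Nat.sub_add_cancel (by omega)] at h3
  rcases eq_or_ne i 0 with rfl | h0
  · rw [rootD_zero]
    simp only [weightedDot_add_left, weightedDot_add_right, weightedDot_unitVec, true_and]
    split_ifs <;> omega
  rcases eq_or_ne i n with rfl | hn'
  · rw [rootD_last h0]
    simp only [weightedDot_sub_left, weightedDot_sub_right, weightedDot_neg_left,
      weightedDot_neg_right, weightedDot_unitVec, true_and]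
    split_ifs <;> omega
  · rw [rootD_mid h0 hn']
    simp only [weightedDot_sub_left, weightedDot_sub_right, weightedDot_unitVec, true_and]
    split_ifs <;> omega

/-- The two roots have disjoint supports, so the parities do not matter. -/
theorem form_rootD_eq_zero {ε : ℕ → Fin 2} {n i j : ℕ}
    (hn : 5 ≤ n) (hij : i + 2 ≤ j) (hj : j ≤ n) (h : ¬(i = 0 ∧ j = 2))
    (h' : ¬(i = n - 2 ∧ j = n)) : form n ε (rootD n i) (rootD n j) = 0 := by
  rw [form_eq_weightedDot]
  rcases eq_or_ne i 0 with rfl | h0 <;> rcases eq_or_ne j n with rfl | hn'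
  · rw [rootD_zero, rootD_last (by omega)]
    simp only [weightedDot_sub_right, weightedDot_neg_right, weightedDot_add_left,
      weightedDot_unitVec]
    split_ifs <;> omega
  · rw [rootD_zero, rootD_mid (by omega) hn']
    simp only [weightedDot_sub_right, weightedDot_add_left, weightedDot_unitVec]
    split_ifs <;> omega
  · rw [rootD_last (by omega), rootD_mid h0 (by omega)]
    simp only [weightedDot_sub_left, weightedDot_sub_right, weightedDot_neg_right,
      weightedDot_unitVec]
    split_ifs <;> omega
  · rw [rootD_mid h0 (by omega), rootD_mid (by omega) hn']
    simp only [weightedDot_sub_left, weightedDot_sub_right, weightedDot_unitVec]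
    split_ifs <;> omega

theorem IsAlternating.halfSystem {ε : ℕ → Fin 2} {p : Kq} (H : IsAlternating ε p) {m : ℕ}
    (hm : 2 ≤ m) {A : Type} [Ring A] [Algebra Kq A] {x : ℕ → A}
    (hx : ∀ r, HalfRel (2 * m + 1) ε x r → r = 0) : HalfSystem m (p + p⁻¹) x := by
  have comm : ∀ i j, i + 2 ≤ j → j ≤ 2 * m + 1 → ¬(i = 0 ∧ j = 2) →
      ¬(i = 2 * m - 1 ∧ j = 2 * m + 1) → x i * x j = x j * x i := fun i j h1 h2 h3 h4 =>
    sub_eq_zero.1 (hx _ (.comm i j (by omega) h2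
      (form_rootD_eq_zero (by omega) h1 h2 h3 (by omega))))
  have e2 : 2 * m + 1 - 2 = 2 * m - 1 := by omega
  have e3 : 2 * m + 1 - 3 = 2 * m - 2 := by omega
  have n2 : ε (2 * m - 1) ≠ ε (2 * m) := by
    have := H.ne_succ (2 * m - 1)
    rwa [Nat.sub_add_cancel (by omega)] at this
  have s2 := H.stwo_eq 2
  have s3 := H.stwo_eq 3
  have sn := H.stwo_eq (2 * m)
  have sn2 := H.stwo_eq (2 * m - 1)
  rw [if_pos (by norm_num)] at s2
  rw [if_neg (by norm_num)] at s3
  rw [if_pos (by omega)] at sn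
  rw [if_neg (by omega)] at sn2
  refine ⟨?_, comm, ?_, ?_, ?_, ?_, ?_, ?_⟩
  · intro i hi
    rw [← pow_two]
    exact hx _ (.odd_sq i hi (H.form_self (by omega) hi))
  · have h := hx _ (.head_fork (H.ne_succ 1))
    rw [s2] at h
    exact h
  · have h := hx _ (.tail_fork (H.ne_succ (2 * m)))
    rw [Nat.add_sub_cancel, sn, e2] at h
    exact fork_of_rev h
  · intro i h1 h2
    have h := hx _ (.quartic (2 * i) (by omega) (H.ne_succ _))
    rw [H.stwo_eq, if_pos (by omega)] at h
    exact h
  · intro i h1 h2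
    have h := hx _ (.quartic (2 * i + 1) (by omega) (H.ne_succ _))
    rw [H.stwo_eq, if_neg (by omega), Nat.add_sub_cancel] at h
    have h' := Quartic.symm (comm _ _ (by omega) (by omega) (by omega) (by omega)) h
    rwa [neg_neg] at h'
  · have h := hx _ (.head_quartic (H.ne_succ 2))
    have c := comm 0 3 (by omega) (by omega) (by omega) (by omega)
    rw [s3] at h
    exact quartic_of_rev c h
  · have h := hx _ (.tail_quartic (by rw [e2]; exact n2))
    rw [e2, e3, sn2] at h
    have h' := Quartic.symm (comm _ _ (by omega) (by omega) (by omega) (by omega)) h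
    rwa [neg_neg] at h'

/-! ### Root systems of types `C_m^{(1)}` and `D_{m+1}^{(1)}` -/

theorem cartan_apply {J : Type} {N : ℕ} (α : J → Fin N → ℤ) (i j : J) :
    cartan α i j = 2 * weightedDot (fun _ => 1) (α i) (α j) /
      weightedDot (fun _ => 1) (α i) (α i) := by
  rw [← dotProduct_eq_weightedDot, ← dotProduct_eq_weightedDot]
  rfl

theorem symmetrizer_apply {J : Type} {N : ℕ} (α : J → Fin N → ℤ) (i : J) :
    symmetrizer α i = weightedDot (fun _ => 1) (α i) (α i) / 2 := by
  rw [← dotProduct_eq_weightedDot]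
  rfl

section TypeC

variable {m : ℕ}

theorem simpleC_zero {i : Fin (m + 1)} (h : i.val = 0) :
    simpleC m i = unitVec m 1 + unitVec m 1 := by
  simp [simpleC, h, two_mul]

theorem simpleC_last {i : Fin (m + 1)} (hm : m ≠ 0) (h : i.val = m) :
    simpleC m i = -(unitVec m m + unitVec m m) := by
  simp [simpleC, h, hm, two_mul]

theorem simpleC_mid {i : Fin (m + 1)} (h0 : i.val ≠ 0) (h : i.val ≠ m) :
    simpleC m i = unitVec m (i.val + 1) - unitVec m i.val := by
  simp [simpleC, h, h0]

theorem simpleC_dot_self (hm : 2 ≤ m) (i : Fin (m + 1)) :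
    weightedDot (fun _ => 1) (simpleC m i) (simpleC m i) =
      if i.val = 0 ∨ i.val = m then 4 else 2 := by
  have := i.isLt
  rcases eq_or_ne i.val 0 with h | h
  · rw [simpleC_zero h, if_pos (.inl h)]
    simp only [weightedDot_add_left, weightedDot_add_right, weightedDot_unitVec, true_and]
    split_ifs <;> omega
  rcases eq_or_ne i.val m with h' | h'
  · rw [simpleC_last (by omega) h', if_pos (.inr h')]
    simp only [weightedDot_add_left, weightedDot_add_right, weightedDot_neg_left,
      weightedDot_neg_right, weightedDot_unitVec, true_and]
    split_ifs <;> omega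
  · rw [simpleC_mid h h', if_neg (by omega)]
    simp only [weightedDot_sub_left, weightedDot_sub_right, weightedDot_unitVec, true_and]
    split_ifs <;> omega

theorem simpleC_dot_of_lt (hm : 2 ≤ m) {i j : Fin (m + 1)} (hij : i.val < j.val) :
    weightedDot (fun _ => 1) (simpleC m i) (simpleC m j) =
      if i.val + 1 = j.val then (if i.val = 0 ∨ j.val = m then -2 else -1) else 0 := by
  have := j.isLt
  rcases eq_or_ne i.val 0 with h | h <;> rcases eq_or_ne j.val m with h' | h'
  · rw [simpleC_zero h, simpleC_last (by omega) h']
    simp only [weightedDot_add_left, weightedDot_add_right, weightedDot_neg_right,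
      weightedDot_unitVec]
    split_ifs <;> omega
  · rw [simpleC_zero h, simpleC_mid (by omega) h']
    simp only [weightedDot_add_left, weightedDot_sub_right, weightedDot_unitVec]
    split_ifs <;> omega
  · rw [simpleC_mid h (by omega), simpleC_last (by omega) h']
    simp only [weightedDot_add_right, weightedDot_neg_right, weightedDot_sub_left,
      weightedDot_unitVec]
    split_ifs <;> omega
  · rw [simpleC_mid h (by omega), simpleC_mid (by omega) h']
    simp only [weightedDot_sub_right, weightedDot_sub_left, weightedDot_unitVec]
    split_ifs <;> omega

theorem symmetrizer_simpleC (hm : 2 ≤ m) (i : Fin (m + 1)) :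
    symmetrizer (simpleC m) i = if i.val = 0 ∨ i.val = m then 2 else 1 := by
  rw [symmetrizer_apply, simpleC_dot_self hm]
  split_ifs <;> rfl

theorem cartan_simpleC_self (hm : 2 ≤ m) (i : Fin (m + 1)) : cartan (simpleC m) i i = 2 := by
  rw [cartan_apply, simpleC_dot_self hm]
  split_ifs <;> rfl

theorem cartan_simpleC_of_lt (hm : 2 ≤ m) {i j : Fin (m + 1)} (hij : i.val < j.val) :
    cartan (simpleC m) i j =
      if i.val + 1 = j.val then (if i.val ≠ 0 ∧ j.val = m then -2 else -1) else 0 := by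
  rw [cartan_apply, simpleC_dot_self hm, simpleC_dot_of_lt hm hij]
  split_ifs <;> first | rfl | omega

theorem cartan_simpleC_of_gt (hm : 2 ≤ m) {i j : Fin (m + 1)} (hij : i.val < j.val) :
    cartan (simpleC m) j i =
      if i.val + 1 = j.val then (if i.val = 0 ∧ j.val ≠ m then -2 else -1) else 0 := by
  rw [cartan_apply, simpleC_dot_self hm, weightedDot_comm, simpleC_dot_of_lt hm hij]
  split_ifs <;> first | rfl | omega

theorem symmetrizer_mul_cartan_simpleC (hm : 2 ≤ m) (i j : Fin (m + 1)) :
    symmetrizer (simpleC m) i * cartan (simpleC m) i j =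
      weightedDot (fun _ => 1) (simpleC m i) (simpleC m j) := by
  rcases lt_trichotomy i.val j.val with h | h | h
  · rw [symmetrizer_simpleC hm, cartan_simpleC_of_lt hm h, simpleC_dot_of_lt hm h]
    split_ifs <;> first | rfl | omega
  · obtain rfl := Fin.ext h
    rw [symmetrizer_simpleC hm, cartan_simpleC_self hm, simpleC_dot_self hm]
    split_ifs <;> rfl
  · rw [symmetrizer_simpleC hm, cartan_simpleC_of_gt hm h, weightedDot_comm,
      simpleC_dot_of_lt hm h]
    split_ifs <;> first | rfl | omega

/-- In the sum of the two roots of a pair the odd coordinate cancels, and `ε_a ↔ δ_{2a}` matches it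
with a simple root of type `C`. The common shape `σ ε_a + τ ε_b` covers long roots (`a = b`) and
short ones, so all inner products can be compared at once. -/
theorem exists_simpleC_eq (hm : 2 ≤ m) (i : Fin (m + 1)) : ∃ (a b : ℕ) (σ τ : ℤ),
    simpleC m i = σ • unitVec m a + τ • unitVec m b ∧
      rootD (2 * m + 1) (2 * i.val) + rootD (2 * m + 1) (2 * i.val + 1) =
        σ • unitVec (2 * m + 1) (2 * a) + τ • unitVec (2 * m + 1) (2 * b) := by
  have := i.isLt
  rcases eq_or_ne i.val 0 with h | h
  · refine ⟨1, 1, 1, 1, by rw [simpleC_zero h, one_smul], ?_⟩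
    rw [h, mul_zero, zero_add, rootD_zero, rootD_mid (by omega) (by omega)]
    simp only [one_smul, mul_one, Nat.reduceAdd]
    abel
  rcases eq_or_ne i.val m with h' | h'
  · refine ⟨m, m, -1, -1, by rw [simpleC_last (by omega) h', neg_one_smul]; abel, ?_⟩
    rw [h', rootD_last (by omega), rootD_mid (by omega) (by omega), Nat.add_sub_cancel]
    simp only [neg_smul, one_smul]
    abel
  · refine ⟨i.val + 1, i.val, 1, -1, by rw [simpleC_mid h h', one_smul, neg_one_smul]; abel, ?_⟩
    rw [rootD_mid (by omega) (by omega), rootD_mid (by omega) (by omega)]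
    simp only [neg_smul, one_smul, mul_add, mul_one, add_assoc, Nat.reduceAdd]
    abel

theorem weightedDot_unitVec_even (m a b : ℕ) :
    weightedDot evenWeight (unitVec (2 * m + 1) (2 * a)) (unitVec (2 * m + 1) (2 * b)) =
      weightedDot (fun _ => 1) (unitVec m a) (unitVec m b) := by
  rw [weightedDot_unitVec, weightedDot_unitVec]
  unfold evenWeight
  split_ifs <;> omega

theorem weightedDot_unitVec_even' (m a b : ℕ) :
    weightedDot oddWeight (unitVec (2 * m + 1) (2 * a)) (unitVec (2 * m + 1) (2 * b)) = 0 := by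
  rw [weightedDot_unitVec]
  unfold oddWeight
  split_ifs <;> omega

theorem weightedDot_pairC (hm : 2 ≤ m) (i j : Fin (m + 1)) :
    weightedDot evenWeight
        (rootD (2 * m + 1) (2 * i.val) + rootD (2 * m + 1) (2 * i.val + 1))
        (rootD (2 * m + 1) (2 * j.val) + rootD (2 * m + 1) (2 * j.val + 1)) =
      weightedDot (fun _ => 1) (simpleC m i) (simpleC m j) ∧
    weightedDot oddWeight
        (rootD (2 * m + 1) (2 * i.val) + rootD (2 * m + 1) (2 * i.val + 1))
        (rootD (2 * m + 1) (2 * j.val) + rootD (2 * m + 1) (2 * j.val + 1)) = 0 := by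
  obtain ⟨a, b, σ, τ, h1, h2⟩ := exists_simpleC_eq hm i
  obtain ⟨a', b', σ', τ', h1', h2'⟩ := exists_simpleC_eq hm j
  rw [h1, h2, h1', h2']
  simp only [weightedDot_add_left, weightedDot_add_right, weightedDot_smul_left,
    weightedDot_smul_right, weightedDot_unitVec_even, weightedDot_unitVec_even', mul_zero,
    add_zero, and_self]

end TypeC

section TypeD

variable {m : ℕ}

theorem simpleD_zero {i : Fin (m + 1 + 1)} (h : i.val = 0) :
    simpleD (m + 1) i = unitVec (m + 1) 1 + unitVec (m + 1) 2 := by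
  rw [simpleD, h, rootD_zero]

theorem simpleD_last {i : Fin (m + 1 + 1)} (h : i.val = m + 1) :
    simpleD (m + 1) i = -unitVec (m + 1) (m + 1) - unitVec (m + 1) m := by
  rw [simpleD, h, rootD_last (by omega), Nat.add_sub_cancel]

theorem simpleD_mid {i : Fin (m + 1 + 1)} (h0 : i.val ≠ 0) (h : i.val ≠ m + 1) :
    simpleD (m + 1) i = unitVec (m + 1) (i.val + 1) - unitVec (m + 1) i.val := by
  rw [simpleD, rootD_mid h0 h]

theorem simpleD_dot_self (hm : 2 ≤ m) (i : Fin (m + 1 + 1)) :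
    weightedDot (fun _ => 1) (simpleD (m + 1) i) (simpleD (m + 1) i) = 2 := by
  have := i.isLt
  rcases eq_or_ne i.val 0 with h | h
  · rw [simpleD_zero h]
    simp only [weightedDot_add_left, weightedDot_add_right, weightedDot_unitVec, true_and]
    split_ifs <;> omega
  rcases eq_or_ne i.val (m + 1) with h' | h'
  · rw [simpleD_last h']
    simp only [weightedDot_sub_left, weightedDot_sub_right, weightedDot_neg_left,
      weightedDot_neg_right, weightedDot_unitVec, true_and]
    split_ifs <;> omega
  · rw [simpleD_mid h h']
    simp only [weightedDot_sub_left, weightedDot_sub_right, weightedDot_unitVec, true_and]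
    split_ifs <;> omega

/-- For `m = 2` the diagram of `D_3^{(1)}` is the 4-cycle of `A_3^{(1)}`: the two end nodes become
adjacent, which is the last alternative. -/
theorem simpleD_dot_of_lt (hm : 2 ≤ m) {i j : Fin (m + 1 + 1)} (hij : i.val < j.val) :
    weightedDot (fun _ => 1) (simpleD (m + 1) i) (simpleD (m + 1) j) =
      if (i.val ≠ 0 ∧ i.val + 1 = j.val ∧ j.val ≠ m + 1) ∨ (i.val = 0 ∧ j.val = 2) ∨
        (i.val + 1 = m ∧ j.val = m + 1) ∨ (i.val = 0 ∧ j.val = m + 1 ∧ m = 2) then -1 else 0 := by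
  have := j.isLt
  rcases eq_or_ne i.val 0 with h | h <;> rcases eq_or_ne j.val (m + 1) with h' | h'
  · rw [simpleD_zero h, simpleD_last h']
    simp only [weightedDot_add_left, weightedDot_sub_right, weightedDot_neg_right,
      weightedDot_unitVec]
    split_ifs <;> omega
  · rw [simpleD_zero h, simpleD_mid (by omega) h']
    simp only [weightedDot_add_left, weightedDot_sub_right, weightedDot_unitVec]
    split_ifs <;> omega
  · rw [simpleD_mid h (by omega), simpleD_last h']
    simp only [weightedDot_sub_right, weightedDot_neg_right, weightedDot_sub_left,
      weightedDot_unitVec]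
    split_ifs <;> omega
  · rw [simpleD_mid h (by omega), simpleD_mid (by omega) h']
    simp only [weightedDot_sub_right, weightedDot_sub_left, weightedDot_unitVec]
    split_ifs <;> omega

theorem symmetrizer_simpleD (hm : 2 ≤ m) (i : Fin (m + 1 + 1)) :
    symmetrizer (simpleD (m + 1)) i = 1 := by
  rw [symmetrizer_apply, simpleD_dot_self hm]
  rfl

theorem cartan_simpleD (hm : 2 ≤ m) (i j : Fin (m + 1 + 1)) :
    cartan (simpleD (m + 1)) i j =
      weightedDot (fun _ => 1) (simpleD (m + 1) i) (simpleD (m + 1) j) := by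
  rw [cartan_apply, simpleD_dot_self hm, Int.mul_ediv_cancel_left _ (by norm_num)]

/-- The first index of the `j`-th pair of simple roots of `𝓤_D(ε)` giving type `D`. -/
def fstD (m j : ℕ) : ℕ := if j = 0 then 0 else if j = m + 1 then 2 * m - 1 else 2 * j - 1

/-- The second index of the `j`-th pair of simple roots of `𝓤_D(ε)` giving type `D`. -/
def sndD (m j : ℕ) : ℕ := if j = 0 then 2 else if j = m + 1 then 2 * m + 1 else 2 * j

theorem fstD_zero (m : ℕ) : fstD m 0 = 0 := if_pos rfl

theorem sndD_zero (m : ℕ) : sndD m 0 = 2 := if_pos rfl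

theorem fstD_last (m : ℕ) : fstD m (m + 1) = 2 * m - 1 := by simp [fstD]

theorem sndD_last (m : ℕ) : sndD m (m + 1) = 2 * m + 1 := by simp [sndD]

theorem fstD_mid {j : ℕ} (h0 : j ≠ 0) (h : j ≠ m + 1) : fstD m j = 2 * j - 1 := by
  simp [fstD, h0, h]

theorem sndD_mid {j : ℕ} (h0 : j ≠ 0) (h : j ≠ m + 1) : sndD m j = 2 * j := by
  simp [sndD, h0, h]

/-- Here the even coordinate cancels, and the dictionary is `ε_{a+1} ↔ δ_{2a+1}`. -/
theorem exists_simpleD_eq (hm : 2 ≤ m) (i : Fin (m + 1 + 1)) : ∃ (a b : ℕ) (σ τ : ℤ),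
    simpleD (m + 1) i = σ • unitVec (m + 1) (a + 1) + τ • unitVec (m + 1) (b + 1) ∧
      rootD (2 * m + 1) (fstD m i.val) + rootD (2 * m + 1) (sndD m i.val) =
        σ • unitVec (2 * m + 1) (2 * a + 1) + τ • unitVec (2 * m + 1) (2 * b + 1) := by
  have := i.isLt
  rcases eq_or_ne i.val 0 with h | h
  · refine ⟨0, 1, 1, 1, by rw [simpleD_zero h, one_smul, one_smul], ?_⟩
    rw [h, fstD_zero, sndD_zero, rootD_zero, rootD_mid (by omega) (by omega)]
    simp only [one_smul, mul_one, mul_zero, zero_add, Nat.reduceAdd]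
    abel
  rcases eq_or_ne i.val (m + 1) with h' | h'
  · refine ⟨m, m - 1, -1, -1, ?_, ?_⟩
    · rw [simpleD_last h', Nat.sub_add_cancel (by omega), neg_one_smul, neg_one_smul]
      abel
    rw [h', fstD_last, sndD_last, rootD_last (by omega),
      rootD_mid (by omega) (by omega), Nat.add_sub_cancel, Nat.sub_add_cancel (by omega),
      show 2 * (m - 1) + 1 = 2 * m - 1 by omega]
    simp only [neg_smul, one_smul]
    abel
  · refine ⟨i.val, i.val - 1, 1, -1, ?_, ?_⟩
    · rw [simpleD_mid h h', Nat.sub_add_cancel (by omega), one_smul, neg_one_smul]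
      abel
    rw [fstD_mid h h', sndD_mid h h', rootD_mid (by omega) (by omega),
      rootD_mid (by omega) (by omega), Nat.sub_add_cancel (by omega),
      show 2 * (i.val - 1) + 1 = 2 * i.val - 1 by omega]
    simp only [neg_smul, one_smul]
    abel

theorem weightedDot_unitVec_odd (m a b : ℕ) :
    weightedDot oddWeight (unitVec (2 * m + 1) (2 * a + 1)) (unitVec (2 * m + 1) (2 * b + 1)) =
      weightedDot (fun _ => 1) (unitVec (m + 1) (a + 1)) (unitVec (m + 1) (b + 1)) := by
  rw [weightedDot_unitVec, weightedDot_unitVec]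
  unfold oddWeight
  split_ifs <;> omega

theorem weightedDot_unitVec_odd' (m a b : ℕ) :
    weightedDot evenWeight (unitVec (2 * m + 1) (2 * a + 1))
      (unitVec (2 * m + 1) (2 * b + 1)) = 0 := by
  rw [weightedDot_unitVec]
  unfold evenWeight
  split_ifs <;> omega

theorem weightedDot_pairD (hm : 2 ≤ m) (i j : Fin (m + 1 + 1)) :
    weightedDot oddWeight
        (rootD (2 * m + 1) (fstD m i.val) + rootD (2 * m + 1) (sndD m i.val))
        (rootD (2 * m + 1) (fstD m j.val) + rootD (2 * m + 1) (sndD m j.val)) =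
      weightedDot (fun _ => 1) (simpleD (m + 1) i) (simpleD (m + 1) j) ∧
    weightedDot evenWeight
        (rootD (2 * m + 1) (fstD m i.val) + rootD (2 * m + 1) (sndD m i.val))
        (rootD (2 * m + 1) (fstD m j.val) + rootD (2 * m + 1) (sndD m j.val)) = 0 := by
  obtain ⟨a, b, σ, τ, h1, h2⟩ := exists_simpleD_eq hm i
  obtain ⟨a', b', σ', τ', h1', h2'⟩ := exists_simpleD_eq hm j
  rw [h1, h2, h1', h2']
  simp only [weightedDot_add_left, weightedDot_add_right, weightedDot_smul_left,
    weightedDot_smul_right, weightedDot_unitVec_odd, weightedDot_unitVec_odd', mul_zero,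
    add_zero, and_self]

end TypeD

/-! ### Brackets, their reversal, and Serre relations on them. -/

section Bracket

variable {K A : Type*} [Field K] [Ring A] [Algebra K A]

/-- The `c`-commutator. -/
def bracket (c : K) (x y : A) : A := x * y - c • (y * x)

theorem bracket_eq_smul {c : K} (hc : c ≠ 0) (a b : A) :
    bracket c b a = (-c) • bracket c⁻¹ a b := bracket_swap hc a b

theorem bracket_inv_eq_smul {c : K} (hc : c ≠ 0) (a b : A) :
    bracket c⁻¹ b a = (-c⁻¹) • bracket c a b := by
  rw [bracket_eq_smul (inv_ne_zero hc), inv_inv]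

theorem mul_bracket_comm {c : K} {v a b : A} (ha : v * a = a * v) (hb : v * b = b * v) :
    v * bracket c a b = bracket c a b * v := by
  unfold bracket
  simp only [mul_sub, sub_mul, mul_smul_comm, smul_mul_assoc]
  rw [← mul_assoc, ha, mul_assoc, hb, ← mul_assoc, ← mul_assoc, hb, mul_assoc b, ha, ← mul_assoc]

theorem bracket_mul_bracket_comm {c c' : K} {u v a b : A} (h1 : u * a = a * u) (h2 : u * b = b * u)
    (h3 : v * a = a * v) (h4 : v * b = b * v) :
    bracket c u v * bracket c' a b = bracket c' a b * bracket c u v :=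
  (mul_bracket_comm (mul_bracket_comm h1 h2).symm (mul_bracket_comm h3 h4).symm).symm

theorem smul_mul_smul_comm_of_comm {E F : A} (h : E * F = F * E) (r r' : K) :
    (r • E) * (r' • F) = (r' • F) * (r • E) := by
  rw [smul_mul_smul_comm, smul_mul_smul_comm, h, mul_comm r]

theorem CubicSerre.bracket_left {s c : K} {E u v : A} (h : CubicSerre s E u)
    (hv : v * E = E * v) : CubicSerre s E (bracket c u v) :=
  (h.mul_right hv).sub_smul (h.mul_left hv)

theorem CubicSerre.bracket_right {s c : K} {E u v : A} (h : CubicSerre s E u)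
    (hv : v * E = E * v) : CubicSerre s E (bracket c v u) :=
  (h.mul_left hv).sub_smul (h.mul_right hv)

theorem CubicSerre.bracket {p c : K} (hp : p ≠ 0) {E u v : A} (hu : CubicSerre (p + p⁻¹) E u)
    (hv : CubicSerre (p + p⁻¹) E v) :
    QuarticSerre (p ^ 2 + 1 + (p ^ 2)⁻¹) E (bracket c u v) :=
  (hu.mul hp hv).sub_smul (hv.mul hp hu)

end Bracket

/-! ### Serre relations between the paired generators. -/

namespace HalfSystem

variable {K A : Type*} [Field K] [Ring A] [Algebra K A] {m : ℕ} {p : K} {x : ℕ → A}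

theorem comm' {s : K} (S : HalfSystem m s x) {i j : ℕ} (h : i ≤ 2 * m + 1 ∧ j ≤ 2 * m + 1 ∧
    (i + 2 ≤ j ∨ j + 2 ≤ i) ∧ ¬(i = 0 ∧ j = 2) ∧ ¬(j = 0 ∧ i = 2) ∧
    ¬(i = 2 * m - 1 ∧ j = 2 * m + 1) ∧ ¬(j = 2 * m - 1 ∧ i = 2 * m + 1)) :
    x i * x j = x j * x i := by
  obtain ⟨hi, hj, h | h, h1, h2, h3, h4⟩ := h
  · exact S.comm i j h hj h1 h3
  · exact (S.comm j i h hi h2 h4).symm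

/-! #### Type `C` -/

section TypeC

variable {c c' : K}

theorem hat_comm {s : K} (S : HalfSystem m s x) {i j : ℕ} (hij : i + 2 ≤ j) (hj : j ≤ m) :
    bracket c (x (2 * i)) (x (2 * i + 1)) * bracket c' (x (2 * j)) (x (2 * j + 1)) =
      bracket c' (x (2 * j)) (x (2 * j + 1)) * bracket c (x (2 * i)) (x (2 * i + 1)) :=
  bracket_mul_bracket_comm (S.comm' (by omega)) (S.comm' (by omega)) (S.comm' (by omega))
    (S.comm' (by omega))

theorem hat_right (S : HalfSystem m (p + p⁻¹) x) (hp : p ≠ 0)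
    (hc : c = -p ∨ c = -p⁻¹) {i : ℕ} (h1 : 1 ≤ i) (h2 : i < m) :
    CubicSerre (p + p⁻¹) (bracket c (x (2 * i)) (x (2 * i + 1))) (x (2 * i + 2)) :=
  (S.quartic_odd i h1 h2).bracket hp hc (S.sq _ (by omega)) (S.sq _ (by omega))
    (S.comm' (by omega))

theorem hat_left (S : HalfSystem m (p + p⁻¹) x) (hp : p ≠ 0)
    (hc : c = -p ∨ c = -p⁻¹) {i : ℕ} (h1 : 1 ≤ i) (h2 : i < m) :
    CubicSerre (p + p⁻¹) (bracket c (x (2 * i)) (x (2 * i + 1))) (x (2 * i - 1)) :=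
  (S.quartic_even i h1 h2).bracket' hp hc (S.sq _ (by omega)) (S.sq _ (by omega))
    (S.comm' (by omega))

/-- Of the two letters of the neighbouring bracket only the nearer one fails to commute with this
bracket, so its cubic relation passes to the whole neighbour. -/
theorem hat_cubic_succ (S : HalfSystem m (p + p⁻¹) x) (hp : p ≠ 0)
    (hc : c = -p ∨ c = -p⁻¹) {i : ℕ} (h1 : 1 ≤ i) (h2 : i + 1 < m) :
    CubicSerre (p + p⁻¹) (bracket c (x (2 * i)) (x (2 * i + 1)))
      (bracket c' (x (2 * (i + 1))) (x (2 * (i + 1) + 1))) :=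
  (S.hat_right hp hc h1 (by omega)).bracket_left
    (mul_bracket_comm (S.comm' (by omega)) (S.comm' (by omega)))

theorem hat_cubic_pred (S : HalfSystem m (p + p⁻¹) x) (hp : p ≠ 0)
    (hc : c = -p ∨ c = -p⁻¹) {i : ℕ} (h1 : 1 ≤ i) (h2 : i + 1 < m) :
    CubicSerre (p + p⁻¹) (bracket c (x (2 * (i + 1))) (x (2 * (i + 1) + 1)))
      (bracket c' (x (2 * i)) (x (2 * i + 1))) :=
  (S.hat_left hp hc (i := i + 1) (by omega) h2).bracket_right
    (mul_bracket_comm (S.comm' (by omega)) (S.comm' (by omega)))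

/-- At the fork both `x 0` and `x 1` meet the short-root bracket, each through a cubic relation;
hence the quartic relation on their bracket. -/
theorem hat_quartic_head (S : HalfSystem m (p + p⁻¹) x) (hm : 2 ≤ m) (hp : p ≠ 0)
    (hc : c = -p ∨ c = -p⁻¹) :
    QuarticSerre (p ^ 2 + 1 + (p ^ 2)⁻¹) (bracket c (x 2) (x 3)) (bracket c' (x 0) (x 1)) :=
  CubicSerre.bracket hp
    (S.head_quartic.bracket' hp hc (S.sq _ (by omega)) (S.sq _ (by omega)) (S.comm' (by omega)))
    (S.hat_left hp hc (i := 1) le_rfl (by omega))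

theorem hat_quartic_tail (S : HalfSystem m (p + p⁻¹) x) (hm : 2 ≤ m) (hp : p ≠ 0)
    (hc : c = -p ∨ c = -p⁻¹) :
    QuarticSerre (p ^ 2 + 1 + (p ^ 2)⁻¹) (bracket c (x (2 * m - 2)) (x (2 * m - 1)))
      (bracket c' (x (2 * m)) (x (2 * m + 1))) := by
  refine CubicSerre.bracket hp ?_ (S.tail_quartic.bracket hp hc (S.sq _ (by omega))
    (S.sq _ (by omega)) (S.comm' (by omega)))
  obtain ⟨k, rfl⟩ : ∃ k, m = k + 1 := ⟨m - 1, by omega⟩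
  exact S.hat_right hp hc (i := k) (by omega) (by omega)

theorem hat_cubic_head (S : HalfSystem m (p + p⁻¹) x) (hm : 2 ≤ m) (hp : p ≠ 0)
    (hc : c = -p ^ 2 ∨ c = -(p ^ 2)⁻¹) :
    CubicSerre (p ^ 2 + (p ^ 2)⁻¹) (bracket c (x 0) (x 1)) (bracket c' (x 2) (x 3)) :=
  (S.head_fork.bracket hp hc (S.sq _ (by omega)) (S.sq _ (by omega))).bracket_left
    (mul_bracket_comm (S.comm' (by omega)) (S.comm' (by omega)))

theorem hat_cubic_tail (S : HalfSystem m (p + p⁻¹) x) (hm : 2 ≤ m) (hp : p ≠ 0)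
    (hc : c = -p ^ 2 ∨ c = -(p ^ 2)⁻¹) :
    CubicSerre (p ^ 2 + (p ^ 2)⁻¹) (bracket c (x (2 * m)) (x (2 * m + 1)))
      (bracket c' (x (2 * m - 2)) (x (2 * m - 1))) :=
  (S.tail_fork.symm.bracket hp hc (S.sq _ (by omega)) (S.sq _ (by omega))).bracket_right
    (mul_bracket_comm (S.comm' (by omega)) (S.comm' (by omega)))

end TypeC

/-! #### Type `D` -/

section TypeD

variable {d d' : K}

/-- In type `D` the parameter of the target relation is the negative inverse of that of the half
system, hence the sign in the coefficient; `Quartic.symm` removes it. -/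
theorem check_cubic (S : HalfSystem m (-(p + p⁻¹)) x) (hp : p ≠ 0) (hd : d = -p ∨ d = -p⁻¹)
    {a b u v : ℕ} (ha : a ≤ 2 * m + 1) (hb : b ≤ 2 * m + 1)
    (hau : x a * x u = x u * x a) (hav : x a * x v = x v * x a) (hbv : x b * x v = x v * x b)
    (h : Quartic (-(p + p⁻¹)) (x b) (x a) (x u)) :
    CubicSerre (p + p⁻¹) (bracket d (x a) (x b)) (bracket d' (x u) (x v)) := by
  have h' := h.symm hau
  rw [neg_neg] at h'
  exact (h'.bracket hp hd (S.sq a ha) (S.sq b hb) hau.symm).bracket_left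
    (mul_bracket_comm hav.symm hbv.symm)

theorem check_cubic' (S : HalfSystem m (-(p + p⁻¹)) x) (hp : p ≠ 0) (hd : d = -p ∨ d = -p⁻¹)
    {a b u v : ℕ} (hu : u ≤ 2 * m + 1) (hv : v ≤ 2 * m + 1)
    (hau : x a * x u = x u * x a) (hav : x a * x v = x v * x a) (hbv : x b * x v = x v * x b)
    (h : Quartic (-(p + p⁻¹)) (x u) (x v) (x b)) :
    CubicSerre (p + p⁻¹) (bracket d (x u) (x v)) (bracket d' (x a) (x b)) := by
  have h' := h.symm hbv.symm
  rw [neg_neg] at h'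
  exact (h'.bracket' hp hd (S.sq v hv) (S.sq u hu) hbv).bracket_right (mul_bracket_comm hau hav)

theorem check_adjacent (S : HalfSystem m (-(p + p⁻¹)) x) (hm : 2 ≤ m) (hp : p ≠ 0)
    (hd : d = -p ∨ d = -p⁻¹) {i j : ℕ}
    (h : (i ≠ 0 ∧ i + 1 = j ∧ j < m + 1) ∨ (i = 0 ∧ j = 2) ∨ (i + 1 = m ∧ j = m + 1) ∨
      (i = 0 ∧ j = m + 1 ∧ m = 2)) :
    CubicSerre (p + p⁻¹) (bracket d (x (fstD m i)) (x (sndD m i)))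
      (bracket d (x (fstD m j)) (x (sndD m j))) ∧
    CubicSerre (p + p⁻¹) (bracket d (x (fstD m j)) (x (sndD m j)))
      (bracket d (x (fstD m i)) (x (sndD m i))) := by
  -- Adjacent pairs interact only through their inner letters `b` and `u`; everything follows from
  -- the quartic relations centred at these two.
  suffices ∃ a b u v, fstD m i = a ∧ sndD m i = b ∧ fstD m j = u ∧ sndD m j = v ∧
      (a < b ∧ b < u ∧ u < v ∧ v ≤ 2 * m + 1 ∧ a + 2 ≤ u ∧ b + 2 ≤ v ∧ (a = 0 → b = 2) ∧
        (v = 2 * m + 1 → u = 2 * m - 1)) ∧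
      Quartic (-(p + p⁻¹)) (x b) (x a) (x u) ∧ Quartic (-(p + p⁻¹)) (x u) (x v) (x b) by
    obtain ⟨a, b, u, v, rfl, rfl, rfl, rfl, hlt, h1, h2⟩ := this
    have c1 := S.comm' (i := fstD m i) (j := fstD m j) (by omega)
    have c2 := S.comm' (i := fstD m i) (j := sndD m j) (by omega)
    have c3 := S.comm' (i := sndD m i) (j := sndD m j) (by omega)
    exact ⟨S.check_cubic hp hd (by omega) (by omega) c1 c2 c3 h1,
      S.check_cubic' hp hd (by omega) (by omega) c1 c2 c3 h2⟩
  rcases h with ⟨h0, rfl, h2⟩ | ⟨rfl, rfl⟩ | ⟨rfl, rfl⟩ | ⟨rfl, rfl, rfl⟩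
  · exact ⟨2 * i - 1, 2 * i, 2 * i + 1, 2 * i + 2, fstD_mid h0 (by omega), sndD_mid h0 (by omega),
      fstD_mid (by omega) (by omega), sndD_mid (by omega) (by omega), by omega,
      S.quartic_even i (by omega) (by omega), S.quartic_odd i (by omega) (by omega)⟩
  · exact ⟨0, 2, 3, 4, rfl, rfl, fstD_mid (by omega) (by omega), sndD_mid (by omega) (by omega),
      by omega, S.head_quartic, S.quartic_odd 1 le_rfl (by omega)⟩
  · exact ⟨2 * i - 1, 2 * i, 2 * i + 1, 2 * i + 3, fstD_mid (by omega) (by omega),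
      sndD_mid (by omega) (by omega), fstD_last _, sndD_last _, by omega,
      S.quartic_even i (by omega) (by omega), S.tail_quartic⟩
  · exact ⟨0, 2, 3, 5, rfl, rfl, rfl, rfl, by omega, S.head_quartic, S.tail_quartic⟩

/-- Two non-adjacent nodes are either the prongs of a fork, whose pairs share the handle letter, or
have pairs of mutually commuting letters. -/
theorem check_comm (S : HalfSystem m (-(p + p⁻¹)) x) (hm : 2 ≤ m) (hp : p ≠ 0)
    (hs : p + p⁻¹ ≠ 0) (hd : d = -p ∨ d = -p⁻¹) {i j : ℕ} (hij : i < j) (hj : j ≤ m + 1)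
    (h : ¬((i ≠ 0 ∧ i + 1 = j ∧ j ≠ m + 1) ∨ (i = 0 ∧ j = 2) ∨ (i + 1 = m ∧ j = m + 1) ∨
      (i = 0 ∧ j = m + 1 ∧ m = 2))) :
    bracket d (x (fstD m i)) (x (sndD m i)) * bracket d (x (fstD m j)) (x (sndD m j)) =
      bracket d (x (fstD m j)) (x (sndD m j)) * bracket d (x (fstD m i)) (x (sndD m i)) := by
  have hd0 := ne_zero_of_neg_inv_or hp hd
  have hds : -(p + p⁻¹) = d + d⁻¹ := by
    rcases hd with rfl | rfl
    · rw [inv_neg]; ring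
    · rw [inv_neg, inv_inv]; ring
  have hs' : d + d⁻¹ ≠ 0 := hds ▸ neg_ne_zero.2 hs
  by_cases h1 : i = 0 ∧ j = 1
  · obtain ⟨rfl, rfl⟩ := h1
    have F := S.head_fork
    rw [hds] at F
    rw [fstD_zero, sndD_zero, fstD_mid one_ne_zero (by omega), sndD_mid one_ne_zero (by omega)]
    exact F.commute_prongs hd0 hs' (S.sq 2 (by omega))
  by_cases h2 : i = m ∧ j = m + 1
  · obtain ⟨rfl, rfl⟩ := h2
    have F := S.tail_fork
    rw [hds, add_comm] at F
    have e5 : d⁻¹ + d = d⁻¹ + d⁻¹⁻¹ := by rw [inv_inv]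
    rw [e5] at F
    rw [fstD_mid (by omega) (by omega), sndD_mid (by omega) (by omega), fstD_last, sndD_last,
      -- At the tail the shared letter `x (2m - 1)` comes first in both brackets; reversing them
      -- puts it last, with `d` replaced by `d⁻¹`.
      bracket_eq_smul hd0 (x (2 * i)),
      bracket_eq_smul hd0 (x (2 * i + 1))]
    refine smul_mul_smul_comm_of_comm (F.commute_prongs (inv_ne_zero hd0) ?_
      (S.sq _ (by omega))).symm _ _
    rwa [inv_inv, add_comm]
  have b1 : fstD m i ≤ 2 * i ∧ (i = 0 → fstD m i = 0) ∧ (i ≠ 0 → 1 ≤ fstD m i) ∧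
      fstD m i + 1 ≤ sndD m i ∧ (i = 0 → sndD m i = 2) ∧ (i ≠ 0 → sndD m i = 2 * i) := by
    unfold fstD sndD
    split_ifs <;> omega
  have b2 : 2 * j ≤ fstD m j + (if j = m + 1 then 3 else 1) ∧ fstD m j + 1 ≤ sndD m j ∧
      sndD m j ≤ 2 * m + 1 ∧ (sndD m j = 2 * m + 1 ↔ j = m + 1) := by
    unfold fstD sndD
    split_ifs <;> omega
  split_ifs at b2 <;>
  exact bracket_mul_bracket_comm (S.comm' (by omega)) (S.comm' (by omega)) (S.comm' (by omega))
    (S.comm' (by omega))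

end TypeD

end HalfSystem

/-! ### From paired generators to a homomorphism. -/

section Pair

variable {K A : Type*} [Field K] [Ring A] [Algebra K A]
variable {n : ℕ} {κ : K} {g : ℕ → ℕ → K} {e f k k' : ℕ → A}

theorem mul_mul_bracket {y z u v : A} {c a b a' b' : K} (h1 : y * u = a • (u * y))
    (h2 : y * v = b • (v * y)) (h3 : z * u = a' • (u * z)) (h4 : z * v = b' • (v * z)) :
    y * z * bracket c u v = (a * a' * (b * b')) • (bracket c u v * (y * z)) := by
  have h1' : ∀ w, y * (u * w) = a • (u * (y * w)) := fun w => by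
    rw [← mul_assoc, h1, smul_mul_assoc, mul_assoc]
  have h2' : ∀ w, y * (v * w) = b • (v * (y * w)) := fun w => by
    rw [← mul_assoc, h2, smul_mul_assoc, mul_assoc]
  have h3' : ∀ w, z * (u * w) = a' • (u * (z * w)) := fun w => by
    rw [← mul_assoc, h3, smul_mul_assoc, mul_assoc]
  have h4' : ∀ w, z * (v * w) = b' • (v * (z * w)) := fun w => by
    rw [← mul_assoc, h4, smul_mul_assoc, mul_assoc]
  unfold bracket
  simp only [mul_sub, sub_mul, mul_smul_comm, smul_mul_assoc, mul_assoc, h3, h4, h1', h2', h3',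
    h4', smul_sub]
  match_scalars <;> ring

theorem zpow_mul_zpow_four {a b : K} (ha : a ≠ 0) (hb : b ≠ 0) (i j k l i' j' k' l' : ℤ) :
    a ^ i * b ^ i' * (a ^ j * b ^ j') * (a ^ k * b ^ k' * (a ^ l * b ^ l')) =
      a ^ (i + j + (k + l)) * b ^ (i' + j' + (k' + l')) := by
  simp only [zpow_add₀ ha, zpow_add₀ hb]
  ring

theorem zpow_eval_one (p : K) : p ^ (1 : ℤ) * (-p⁻¹) ^ (-1 : ℤ) = -p ^ 2 := by
  simp [pow_two]

theorem zpow_eval_zero (p : K) : p ^ (0 : ℤ) * (-p⁻¹) ^ (-1 : ℤ) = -p := by simp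

theorem zpow_eval_neg_one (p : K) : p ^ (-1 : ℤ) * (-p⁻¹) ^ (0 : ℤ) = p⁻¹ := by simp

end Pair

/-- The images of the `f_i` are reversed brackets with inverse parameter, hence multiples of
brackets in the order used for the `e_i`. The Serre relations for both halves thus follow from one
computation, provided it allows arbitrary scalars. -/
theorem serre_bracket_inv {B : Type} [Ring B] [Algebra Kq B] {s : Kq} {a : ℤ} {c c' : Kq}
    (hc : c ≠ 0) (hc' : c' ≠ 0) {u v y z : B}
    (h : ∀ r r' : Kq, serre s a (r • bracket c u v) (r' • bracket c' y z) = 0) (r r' : Kq) :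
    serre s a (r • bracket c⁻¹ v u) (r' • bracket c'⁻¹ z y) = 0 := by
  rw [bracket_inv_eq_smul hc, bracket_inv_eq_smul hc', smul_smul, smul_smul]
  exact h _ _

/-- Pairs of generators whose `q`-commutators satisfy the Serre relations define a homomorphism
from a Drinfeld–Jimbo algebra. -/
theorem exists_sendsGenerators_of_pairs {J : Type} {a : Matrix J J ℤ} {d : J → ℤ} {p : Kq}
    {B : Type} [Ring B] [Algebra Kq B] {n : ℕ} {κ : Kq} {g : ℕ → ℕ → Kq} {e f k k' : ℕ → B}
    (T : Triangular n κ g e f k k') {fst snd : J → ℕ} (hfst : ∀ i, fst i ≤ n)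
    (hsnd : ∀ i, snd i ≤ n) (hne : ∀ i, fst i ≠ snd i) {t r r' : J → Kq}
    (ht : ∀ i, t i = g (fst i) (snd i) ∨ t i = (g (fst i) (snd i))⁻¹)
    (hsymm : ∀ i, g (snd i) (fst i) = g (fst i) (snd i))
    (hg : ∀ i j, g (fst i) (fst j) * g (snd i) (fst j) * (g (fst i) (snd j) * g (snd i) (snd j)) =
      (p ^ d i) ^ a i j)
    (hr : ∀ i, r i * r' i * (κ ^ 2 * ((g (fst i) (snd i))⁻¹ - g (fst i) (snd i))) =
      (p ^ d i - (p ^ d i)⁻¹)⁻¹)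
    (hcomm : ∀ i j, i ≠ j →
      bracket (t i) (e (fst i)) (e (snd i)) * bracket (t j)⁻¹ (f (snd j)) (f (fst j)) =
        bracket (t j)⁻¹ (f (snd j)) (f (fst j)) * bracket (t i) (e (fst i)) (e (snd i)))
    (hserre : ∀ x, x = e ∨ x = f → ∀ i j, i ≠ j → ∀ s s' : Kq, serre (p ^ d i) (a i j)
      (s • bracket (t i) (x (fst i)) (x (snd i))) (s' • bracket (t j) (x (fst j)) (x (snd j))) = 0) :
    ∃ φ : DJ a d p →ₐ[Kq] B, SendsGenerators φ
      (fun i => r i • bracket (t i) (e (fst i)) (e (snd i)))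
      (fun i => r' i • bracket (t i)⁻¹ (f (snd i)) (f (fst i)))
      (fun i => k (fst i) * k (snd i)) := by
  have ht0 : ∀ i, t i ≠ 0 := fun i => by
    rcases ht i with h | h <;> rw [h]
    · exact T.ne_zero _ _
    · exact inv_ne_zero (T.ne_zero _ _)
  apply exists_sendsGenerators (K' := fun i => k' (fst i) * k' (snd i))
  · intro i
    rw [T.inv_inv (hfst i) (hsnd i), mul_assoc, ← mul_assoc (k (snd i)), T.mul_inv _ (hsnd i),
      one_mul, T.mul_inv _ (hfst i)]
  · intro i
    rw [T.inv_inv (hfst i) (hsnd i), mul_assoc, ← mul_assoc (k' (fst i)), T.inv_mul _ (hfst i),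
      one_mul, T.inv_mul _ (hsnd i)]
  · intro i j
    have c : ∀ a b, a ≤ n → b ≤ n → Commute (k a) (k b) := T.k_comm
    exact ((c _ _ (hfst i) (hfst j)).mul_right (c _ _ (hfst i) (hsnd j))).mul_left
      ((c _ _ (hsnd i) (hfst j)).mul_right (c _ _ (hsnd i) (hsnd j)))
  · intro i j
    rw [mul_smul_comm, smul_mul_assoc, smul_comm _ (r j), ← hg i j]
    congr 1
    exact mul_mul_bracket (T.k_e _ _ (hfst i) (hfst j)) (T.k_e _ _ (hfst i) (hsnd j))
      (T.k_e _ _ (hsnd i) (hfst j)) (T.k_e _ _ (hsnd i) (hsnd j))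
  · intro i j
    rw [mul_smul_comm, smul_mul_assoc, smul_comm _ (r' j), zpow_neg, ← hg i j]
    congr 1
    rw [mul_inv, mul_inv, mul_inv, mul_comm ((g (fst i) (fst j))⁻¹ * (g (snd i) (fst j))⁻¹)]
    exact mul_mul_bracket (T.k_f _ _ (hfst i) (hsnd j)) (T.k_f _ _ (hfst i) (hfst j))
      (T.k_f _ _ (hsnd i) (hsnd j)) (T.k_f _ _ (hsnd i) (hfst j))
  · intro i
    rw [smul_mul_smul_comm, smul_mul_smul_comm, mul_comm (r' i), ← smul_sub, ← hr i, mul_smul (r i * r' i)]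
    congr 1
    exact T.bracket_self (hfst i) (hsnd i) (hne i) (hsymm i) (ht i)
  · intro i j hij
    exact smul_mul_smul_comm_of_comm (hcomm i j hij) _ _
  · intro i j hij
    exact hserre e (.inl rfl) i j hij _ _
  · intro i j hij
    exact serre_bracket_inv (ht0 i) (ht0 j) (hserre f (.inr rfl) i j hij) _ _

/-! ### Values of the bicharacter on the pairs. -/

namespace IsAlternating

variable {ε : ℕ → Fin 2} {p : Kq}

theorem qform_pair (H : IsAlternating ε p) (n a b c d : ℕ) :
    qform n ε (rootP n a) (rootP n c) * qform n ε (rootP n b) (rootP n c) *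
        (qform n ε (rootP n a) (rootP n d) * qform n ε (rootP n b) (rootP n d)) =
      p ^ weightedDot evenWeight (rootD n a + rootD n b) (rootD n c + rootD n d) *
        (-p⁻¹) ^ weightedDot oddWeight (rootD n a + rootD n b) (rootD n c + rootD n d) := by
  simp only [H.qform_rootP, weightedDot_add_left, weightedDot_add_right]
  exact zpow_mul_zpow_four H.ne_zero (neg_ne_zero.2 (inv_ne_zero H.ne_zero)) _ _ _ _ _ _ _ _

theorem pow_ne_one' (H : IsAlternating ε p) {k : ℕ} (hk : k ∣ 24) : p ^ k ≠ 1 := by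
  obtain ⟨l, hl⟩ := hk
  intro h
  apply H.pow_ne_one
  rw [hl, pow_mul, h, one_pow]

theorem qform_eq (H : IsAlternating ε p) {n a b : ℕ} {k l : ℤ}
    (hk : weightedDot evenWeight (rootD n a) (rootD n b) = k)
    (hl : weightedDot oddWeight (rootD n a) (rootD n b) = l) :
    qform n ε (rootP n a) (rootP n b) = p ^ k * (-p⁻¹) ^ l := by
  rw [H.qform_rootP, hk, hl]

theorem qform_pairC_self (H : IsAlternating ε p) {m i : ℕ} (hm : 2 ≤ m) (hi : i ≤ m) :
    qform (2 * m + 1) ε (rootP (2 * m + 1) (2 * i)) (rootP (2 * m + 1) (2 * i + 1)) =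
      if i = 0 ∨ i = m then -p ^ 2 else -p := by
  have e1 : p ^ (1 : ℤ) * (-p⁻¹) ^ (-1 : ℤ) = -p ^ 2 := zpow_eval_one p
  have e2 : p ^ (0 : ℤ) * (-p⁻¹) ^ (-1 : ℤ) = -p := zpow_eval_zero p
  rcases eq_or_ne i 0 with rfl | h0
  · rw [if_pos (.inl rfl), ← e1]
    apply H.qform_eq <;> rw [mul_zero, rootD_zero, rootD_mid (by omega) (by omega)] <;>
      simp only [weightedDot_add_left, weightedDot_sub_right, weightedDot_unitVec] <;>
      simp [evenWeight, oddWeight] <;> omega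
  rcases eq_or_ne i m with rfl | h1
  · rw [if_pos (.inr rfl), ← e1]
    apply H.qform_eq <;> rw [rootD_mid (by omega) (by omega), rootD_last (by omega)] <;>
      simp only [weightedDot_sub_left, weightedDot_sub_right, weightedDot_neg_right,
        weightedDot_unitVec] <;>
      simp only [evenWeight, oddWeight, true_and] <;> split_ifs <;> omega
  · rw [if_neg (by omega), ← e2]
    apply H.qform_eq <;> rw [rootD_mid (by omega) (by omega), rootD_mid (by omega) (by omega)] <;>
      simp only [weightedDot_sub_left, weightedDot_sub_right, weightedDot_unitVec] <;>
      simp only [evenWeight, oddWeight, true_and] <;> split_ifs <;> omega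

theorem qform_pairD_self (H : IsAlternating ε p) {m i : ℕ} (hm : 2 ≤ m) (hi : i ≤ m + 1) :
    qform (2 * m + 1) ε (rootP (2 * m + 1) (fstD m i)) (rootP (2 * m + 1) (sndD m i)) = p⁻¹ := by
  have e1 : p ^ (-1 : ℤ) * (-p⁻¹) ^ (0 : ℤ) = p⁻¹ := zpow_eval_neg_one p
  rw [← e1]
  rcases eq_or_ne i 0 with rfl | h0
  · apply H.qform_eq <;>
      rw [fstD_zero, sndD_zero, rootD_zero, rootD_mid (by omega) (by omega)] <;>
      simp only [weightedDot_add_left, weightedDot_sub_right, weightedDot_unitVec] <;>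
      simp only [evenWeight, oddWeight, true_and] <;> split_ifs <;> omega
  rcases eq_or_ne i (m + 1) with rfl | h1
  · apply H.qform_eq <;>
      rw [fstD_last, sndD_last, rootD_mid (by omega) (by omega), rootD_last (by omega)] <;>
      simp only [weightedDot_sub_left, weightedDot_sub_right, weightedDot_neg_right,
        weightedDot_unitVec] <;>
      simp only [evenWeight, oddWeight] <;> split_ifs <;> omega
  · apply H.qform_eq <;>
      rw [fstD_mid h0 h1, sndD_mid h0 h1, rootD_mid (by omega) (by omega),
        rootD_mid (by omega) (by omega)] <;>
      simp only [weightedDot_sub_left, weightedDot_sub_right, weightedDot_unitVec] <;>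
      simp only [evenWeight, oddWeight] <;> split_ifs <;> omega

end IsAlternating

/-! ### Normalization of the brackets. -/

section Scalars

variable {K : Type*} [Field K] {p : K}

theorem neg_inv_comm (a : K) : -a⁻¹ = (-a)⁻¹ := inv_neg.symm

theorem sub_inv_ne_zero (h0 : p ≠ 0) (h : p ^ 2 ≠ 1) : p - p⁻¹ ≠ 0 := by
  intro h'
  apply h
  field_simp at h'
  linear_combination h'

theorem add_inv_ne_zero (h0 : p ≠ 0) (h : p ^ 4 ≠ 1) : p + p⁻¹ ≠ 0 := by
  intro h'
  apply h
  field_simp at h'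
  linear_combination (p ^ 2 - 1) * h'

theorem normalization_mid (h0 : p ≠ 0) (h : p ^ 2 ≠ 1) {R : K} (hR : R = 1) :
    R * ((p - p⁻¹)⁻¹ ^ 2 * ((-p)⁻¹ - -p)) = (p - p⁻¹)⁻¹ := by
  have := sub_inv_ne_zero h0 h
  rw [hR, inv_neg, show -p⁻¹ - -p = p - p⁻¹ by ring]
  field_simp

/-- The commutator of the brackets has the scalar `(p + p⁻¹)/(p - p⁻¹)`, while a long root requires
`1/((p + p⁻¹)(p - p⁻¹))`. This forces the factor `1/[2]` on each of `e` and `f` at the end nodes, up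
to sign and reciprocal rescalings. -/
theorem normalization_end (h0 : p ≠ 0) (h : p ^ 4 ≠ 1) {R : K} (hR : R * (p + p⁻¹) ^ 2 = 1) :
    R * ((p - p⁻¹)⁻¹ ^ 2 * ((-p ^ 2)⁻¹ - -p ^ 2)) = (p ^ 2 - (p ^ 2)⁻¹)⁻¹ := by
  have h1 := sub_inv_ne_zero h0 (fun h2 => h (by linear_combination (p ^ 2 + 1) * h2))
  have h2 := add_inv_ne_zero h0 h
  have e : p ^ 2 - (p ^ 2)⁻¹ = (p - p⁻¹) * (p + p⁻¹) := by field_simp; ring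
  have e' : (-p ^ 2)⁻¹ - -p ^ 2 = (p - p⁻¹) * (p + p⁻¹) := by rw [← e, inv_neg]; ring
  have hR' : R = ((p + p⁻¹) ^ 2)⁻¹ := eq_inv_of_mul_eq_one_left hR
  rw [e, e', hR']
  field_simp

theorem normalization_odd (h0 : p ≠ 0) (h : p ^ 2 ≠ 1) {p' R : K} (hp' : p' = -p⁻¹) (hR : R = 1) :
    R * ((p - p⁻¹)⁻¹ ^ 2 * (p⁻¹⁻¹ - p⁻¹)) = (p' - p'⁻¹)⁻¹ := by
  have := sub_inv_ne_zero h0 h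
  rw [hR, hp', inv_neg, inv_inv, show -p⁻¹ - -p = p - p⁻¹ by ring]
  field_simp

end Scalars

section Serre

variable {A : Type} [Ring A] [Algebra Kq A] {s : Kq} {E z : A}

theorem serre_zero_smul (h0 : s ≠ 0) (h : s ^ 2 ≠ 1) (hc : E * z = z * E) (r r' : Kq) :
    serre s 0 (r • E) (r' • z) = 0 := by
  rw [serre_zero h h0, smul_mul_smul_comm_of_comm hc]
  exact sub_self _

theorem CubicSerre.serre_eq_zero (h0 : s ≠ 0) (h : s ^ 4 ≠ 1) (hc : CubicSerre (s + s⁻¹) E z)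
    (r r' : Kq) : serre s (-1) (r • E) (r' • z) = 0 := by
  rw [serre_neg_one h h0]
  exact hc.smul r r'

theorem QuarticSerre.serre_eq_zero (h0 : s ≠ 0) (h : s ^ 4 ≠ 1) (h' : s ^ 6 ≠ 1)
    (hc : QuarticSerre (s ^ 2 + 1 + (s ^ 2)⁻¹) E z) (r r' : Kq) :
    serre s (-2) (r • E) (r' • z) = 0 := by
  rw [serre_neg_two h h' h0]
  exact hc.smul r r'

end Serre

theorem pow_symmetrizer_simpleC (p : Kq) {m : ℕ} (hm : 2 ≤ m) (i : Fin (m + 1)) :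
    p ^ symmetrizer (simpleC m) i = if i.val = 0 ∨ i.val = m then p ^ 2 else p := by
  rw [symmetrizer_simpleC hm]
  split_ifs
  · exact zpow_ofNat p 2
  · exact zpow_one p

/-! ### The homomorphism from type `C`, for either alternating sequence. -/

section TypeC

variable {ε : ℕ → Fin 2} {p : Kq} {m : ℕ}

theorem IsAlternating.serre_pairC (H : IsAlternating ε p) (hm : 2 ≤ m) {A : Type} [Ring A]
    [Algebra Kq A] {x : ℕ → A} (S : HalfSystem m (p + p⁻¹) x) {c : Fin (m + 1) → Kq}
    (hend : ∀ i, i.val = 0 ∨ i.val = m → c i = -p ^ 2 ∨ c i = -(p ^ 2)⁻¹)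
    (hmid : ∀ i, ¬(i.val = 0 ∨ i.val = m) → c i = -p ∨ c i = -p⁻¹)
    {i j : Fin (m + 1)} (hij : i ≠ j) (r r' : Kq) :
    serre (p ^ symmetrizer (simpleC m) i) (cartan (simpleC m) i j)
      (r • bracket (c i) (x (2 * i.val)) (x (2 * i.val + 1)))
      (r' • bracket (c j) (x (2 * j.val)) (x (2 * j.val + 1))) = 0 := by
  have h0 := H.ne_zero
  have h2 := H.pow_ne_one' (k := 2) (by norm_num)
  have h4 := H.pow_ne_one' (k := 4) (by norm_num)
  have h6 := H.pow_ne_one' (k := 6) (by norm_num)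
  have h8 := H.pow_ne_one' (k := 8) (by norm_num)
  have hs0 : p ^ symmetrizer (simpleC m) i ≠ 0 := zpow_ne_zero _ h0
  have hs2 : (p ^ symmetrizer (simpleC m) i) ^ 2 ≠ 1 := by
    rw [pow_symmetrizer_simpleC p hm]
    split_ifs
    · rwa [← pow_mul]
    · exact h2
  have hp20 : p ^ 2 ≠ 0 := pow_ne_zero 2 h0
  have hp24 : (p ^ 2) ^ 4 ≠ 1 := by rwa [← pow_mul]
  have hi := i.isLt
  have hj := j.isLt
  rcases lt_or_gt_of_ne (fun h => hij (Fin.ext h)) with hlt | hlt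
  · rw [cartan_simpleC_of_lt hm hlt]
    by_cases hadj : i.val + 1 = j.val
    · rw [if_pos hadj, pow_symmetrizer_simpleC p hm]
      by_cases hi0 : i.val = 0
      · rw [if_pos (.inl hi0), if_neg (by omega)]
        refine CubicSerre.serre_eq_zero hp20 hp24 ?_ r r'
        rw [← hadj, hi0]
        exact S.hat_cubic_head hm h0 (hend i (.inl hi0))
      by_cases hjm : j.val = m
      · rw [if_neg (by omega), if_pos ⟨hi0, hjm⟩]
        refine QuarticSerre.serre_eq_zero h0 h4 h6 ?_ r r'
        have e1 : 2 * i.val = 2 * m - 2 := by omega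
        have e2 : 2 * i.val + 1 = 2 * m - 1 := by omega
        rw [hjm, e2, e1]
        exact S.hat_quartic_tail hm h0 (hmid i (by omega))
      · rw [if_neg (by omega), if_neg (by omega)]
        refine CubicSerre.serre_eq_zero h0 h4 ?_ r r'
        rw [← hadj]
        exact S.hat_cubic_succ h0 (hmid i (by omega)) (by omega) (by omega)
    · rw [if_neg hadj]
      exact serre_zero_smul hs0 hs2 (S.hat_comm (by omega) (by omega)) r r'
  · rw [cartan_simpleC_of_gt hm hlt]
    by_cases hadj : j.val + 1 = i.val
    · rw [if_pos hadj, pow_symmetrizer_simpleC p hm]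
      by_cases him : i.val = m
      · rw [if_pos (.inr him), if_neg (by omega)]
        refine CubicSerre.serre_eq_zero hp20 hp24 ?_ r r'
        have e1 : 2 * j.val = 2 * m - 2 := by omega
        have e2 : 2 * j.val + 1 = 2 * m - 1 := by omega
        rw [him, e2, e1]
        exact S.hat_cubic_tail hm h0 (hend i (.inr him))
      by_cases hj0 : j.val = 0
      · rw [if_neg (by omega), if_pos ⟨hj0, him⟩]
        refine QuarticSerre.serre_eq_zero h0 h4 h6 ?_ r r'
        rw [← hadj, hj0]
        exact S.hat_quartic_head hm h0 (hmid i (by omega))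
      · rw [if_neg (by omega), if_neg (by omega)]
        refine CubicSerre.serre_eq_zero h0 h4 ?_ r r'
        rw [← hadj]
        exact S.hat_cubic_pred h0 (hmid i (by omega)) (by omega) (by omega)
    · rw [if_neg hadj]
      exact serre_zero_smul hs0 hs2 (S.hat_comm (by omega) (by omega)).symm r r'

theorem bracket_mul_bracket_of_ne {n : ℕ} {κ : Kq} {g : ℕ → ℕ → Kq} {A : Type} [Ring A]
    [Algebra Kq A] {e f k k' : ℕ → A} (T : Triangular n κ g e f k k') {a b u v : ℕ} {c c' : Kq}
    (h : a ≤ n ∧ b ≤ n ∧ u ≤ n ∧ v ≤ n ∧ a ≠ u ∧ a ≠ v ∧ b ≠ u ∧ b ≠ v) :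
    bracket c (e a) (e b) * bracket c' (f u) (f v) =
      bracket c' (f u) (f v) * bracket c (e a) (e b) := by
  obtain ⟨ha, hb, hu, hv, h1, h2, h3, h4⟩ := h
  exact bracket_mul_bracket_comm (T.e_f_ne _ _ ha hu h1) (T.e_f_ne _ _ ha hv h2)
    (T.e_f_ne _ _ hb hu h3) (T.e_f_ne _ _ hb hv h4)

/-- The homomorphism from the quantum affine algebra of type `C_m^{(1)}`. -/
theorem IsAlternating.exists_typeC (H : IsAlternating ε p) (hm : 2 ≤ m)
    {c r r' : Fin (m + 1) → Kq}
    (hend : ∀ i, i.val = 0 ∨ i.val = m → c i = -p ^ 2 ∨ c i = -(p ^ 2)⁻¹)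
    (hmid : ∀ i, ¬(i.val = 0 ∨ i.val = m) → c i = -p ∨ c i = -p⁻¹)
    (hr_end : ∀ i : Fin (m + 1), i.val = 0 ∨ i.val = m → r i * r' i * (p + p⁻¹) ^ 2 = 1)
    (hr_mid : ∀ i : Fin (m + 1), ¬(i.val = 0 ∨ i.val = m) → r i * r' i = 1) :
    ∃ φ : UqC p m →ₐ[Kq] UD (2 * m + 1) ε, SendsGenerators φ
      (fun i => r i • bracket (c i) (UD.e (2 * m + 1) ε (2 * i.val))
        (UD.e (2 * m + 1) ε (2 * i.val + 1)))
      (fun i => r' i • bracket (c i)⁻¹ (UD.f (2 * m + 1) ε (2 * i.val + 1))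
        (UD.f (2 * m + 1) ε (2 * i.val)))
      (fun i => UD.k (2 * m + 1) ε (2 * i.val) * UD.k (2 * m + 1) ε (2 * i.val + 1)) := by
  have h0 := H.ne_zero
  have hle : ∀ i : Fin (m + 1), i.val ≤ m := fun i => by have := i.isLt; omega
  refine exists_sendsGenerators_of_pairs (UD.triangular (n := 2 * m + 1) (ε := ε))
    (fst := fun i : Fin (m + 1) => 2 * i.val) (snd := fun i : Fin (m + 1) => 2 * i.val + 1)
    (fun i => by have := hle i; omega) (fun i => by have := hle i; omega) (fun i => by omega)
    ?_ (fun i => qform_comm _ _) ?_ ?_ ?_ ?_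
  · intro i
    rw [H.qform_pairC_self hm (hle i)]
    split_ifs with h
    · exact (hend i h).imp_right fun h => h.trans (neg_inv_comm _)
    · exact (hmid i h).imp_right fun h => h.trans (neg_inv_comm _)
  · intro i j
    rw [H.qform_pair, (weightedDot_pairC hm i j).1, (weightedDot_pairC hm i j).2, zpow_zero,
      mul_one, ← zpow_mul, symmetrizer_mul_cartan_simpleC hm]
  · intro i
    rw [H.qform_pairC_self hm (hle i), pow_symmetrizer_simpleC p hm, H.sub_inv]
    split_ifs with h
    · exact normalization_end h0 (H.pow_ne_one' (by norm_num)) (hr_end i h)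
    · exact normalization_mid h0 (H.pow_ne_one' (by norm_num)) (hr_mid i h)
  · intro i j hij
    have hi := hle i
    have hj := hle j
    have : i.val ≠ j.val := fun h => hij (Fin.ext h)
    exact bracket_mul_bracket_of_ne UD.triangular (by omega)
  · intro x hx i j hij s s'
    rcases hx with rfl | rfl
    · exact H.serre_pairC hm (H.halfSystem hm fun _ => UD.halfRel_e) hend hmid hij s s'
    · exact H.serre_pairC hm (H.halfSystem hm fun _ => UD.halfRel_f) hend hmid hij s s'

end TypeC

/-! ### The homomorphism from type `D`, for either alternating sequence. -/

section TypeD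

variable {ε : ℕ → Fin 2} {p p' : Kq} {m : ℕ}

theorem pow_symmetrizer_simpleD (p : Kq) (hm : 2 ≤ m) (i : Fin (m + 1 + 1)) :
    p ^ symmetrizer (simpleD (m + 1)) i = p := by
  rw [symmetrizer_simpleD hm]
  exact zpow_one p

theorem IsAlternating.serre_pairD (H : IsAlternating ε p) (hp' : p' = -p⁻¹) (hm : 2 ≤ m)
    {A : Type} [Ring A] [Algebra Kq A] {x : ℕ → A} (S : HalfSystem m (p + p⁻¹) x) {d : Kq}
    (hd : d = p ∨ d = p⁻¹) {i j : Fin (m + 1 + 1)} (hij : i ≠ j) (r r' : Kq) :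
    serre (p' ^ symmetrizer (simpleD (m + 1)) i) (cartan (simpleD (m + 1)) i j)
      (r • bracket d (x (fstD m i.val)) (x (sndD m i.val)))
      (r' • bracket d (x (fstD m j.val)) (x (sndD m j.val))) = 0 := by
  have h0 : p' ≠ 0 := hp' ▸ neg_ne_zero.2 (inv_ne_zero H.ne_zero)
  have hinv : p'⁻¹ = -p := by rw [hp']; exact neg_inv_inv_neg p
  have h2 : p' ^ 2 ≠ 1 := by
    rw [hp', Even.neg_pow (by decide), inv_pow]
    exact inv_ne_one.2 (H.pow_ne_one' (by norm_num))
  have h4 : p' ^ 4 ≠ 1 := by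
    rw [hp', Even.neg_pow (by decide), inv_pow]
    exact inv_ne_one.2 (H.pow_ne_one' (by norm_num))
  have hd' : d = -p' ∨ d = -p'⁻¹ := by
    rw [hinv, hp', neg_neg, neg_neg]
    exact hd.symm
  have hs : p' + p'⁻¹ ≠ 0 := add_inv_ne_zero h0 h4
  have hS : p + p⁻¹ = -(p' + p'⁻¹) := by rw [hinv, hp']; ring
  rw [hS] at S
  have hi := i.isLt
  have hj := j.isLt
  rw [pow_symmetrizer_simpleD p' hm, cartan_simpleD hm]
  rcases lt_or_gt_of_ne (fun h => hij (Fin.ext h)) with hlt | hlt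
  · rw [simpleD_dot_of_lt hm hlt]
    split_ifs with h
    · exact CubicSerre.serre_eq_zero h0 h4 (S.check_adjacent hm h0 hd' (by omega)).1 r r'
    · exact serre_zero_smul h0 h2 (S.check_comm hm h0 hs hd' hlt (by omega) h) r r'
  · rw [weightedDot_comm, simpleD_dot_of_lt hm hlt]
    split_ifs with h
    · exact CubicSerre.serre_eq_zero h0 h4 (S.check_adjacent hm h0 hd' (by omega)).2 r r'
    · exact serre_zero_smul h0 h2 (S.check_comm hm h0 hs hd' hlt (by omega) h).symm r r'

/-- Unlike in type `C`, distinct pairs may share a letter: nodes `0`, `1` share index `2`, and nodes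
`m`, `m + 1` share index `2m - 1`. All other pairs are disjoint, so their letters commute. -/
theorem IsAlternating.bracket_pairD_comm (H : IsAlternating ε p) (hm : 2 ≤ m) {d : Kq}
    (hd : d = p ∨ d = p⁻¹) {i j : ℕ} (hij : i ≠ j) (hi : i ≤ m + 1) (hj : j ≤ m + 1) :
    bracket d (UD.e (2 * m + 1) ε (fstD m i)) (UD.e (2 * m + 1) ε (sndD m i)) *
        bracket d⁻¹ (UD.f (2 * m + 1) ε (sndD m j)) (UD.f (2 * m + 1) ε (fstD m j)) =
      bracket d⁻¹ (UD.f (2 * m + 1) ε (sndD m j)) (UD.f (2 * m + 1) ε (fstD m j)) *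
        bracket d (UD.e (2 * m + 1) ε (fstD m i)) (UD.e (2 * m + 1) ε (sndD m i)) := by
  have hd0 : d ≠ 0 := by
    rcases hd with rfl | rfl
    · exact H.ne_zero
    · exact inv_ne_zero H.ne_zero
  have hdinv : d⁻¹ = p ∨ d⁻¹ = p⁻¹ := by
    rcases hd with rfl | rfl
    · exact .inr rfl
    · exact .inl (inv_inv p)
  have g02 := H.qform_pairD_self hm (i := 0) (by omega)
  have g12 := H.qform_pairD_self hm (i := 1) (by omega)
  have gm := H.qform_pairD_self hm (i := m) (by omega)
  have gm' := H.qform_pairD_self hm (i := m + 1) le_rfl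
  have T := UD.triangular (n := 2 * m + 1) (ε := ε)
  have head : ∀ a b : ℕ, a ≤ 1 → b ≤ 1 → a ≠ b →
      bracket d (UD.e (2 * m + 1) ε a) (UD.e (2 * m + 1) ε 2) *
          bracket d⁻¹ (UD.f (2 * m + 1) ε 2) (UD.f (2 * m + 1) ε b) =
        bracket d⁻¹ (UD.f (2 * m + 1) ε 2) (UD.f (2 * m + 1) ε b) *
          bracket d (UD.e (2 * m + 1) ε a) (UD.e (2 * m + 1) ε 2) := by
    rw [fstD_zero, sndD_zero] at g02
    rw [fstD_mid one_ne_zero (by omega), sndD_mid one_ne_zero (by omega)] at g12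
    have hg : ∀ a : ℕ, a ≤ 1 →
        qform (2 * m + 1) ε (rootP (2 * m + 1) a) (rootP (2 * m + 1) 2) = p⁻¹ := by
      intro a ha
      interval_cases a
      · exact g02
      · exact g12
    intro a b ha hb hab
    refine T.bracket_fork (by omega) (by omega) (by omega) hab (by omega) (by omega)
      (qform_comm _ _) ?_ ?_
    · rw [qform_comm, hg b hb, hg a ha]
    · rw [hg a ha, inv_inv]
      exact hd.symm
  have tail : ∀ a b : ℕ, 2 * m ≤ a → a ≤ 2 * m + 1 → 2 * m ≤ b → b ≤ 2 * m + 1 → a ≠ b →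
      bracket d (UD.e (2 * m + 1) ε (2 * m - 1)) (UD.e (2 * m + 1) ε a) *
          bracket d⁻¹ (UD.f (2 * m + 1) ε b) (UD.f (2 * m + 1) ε (2 * m - 1)) =
        bracket d⁻¹ (UD.f (2 * m + 1) ε b) (UD.f (2 * m + 1) ε (2 * m - 1)) *
          bracket d (UD.e (2 * m + 1) ε (2 * m - 1)) (UD.e (2 * m + 1) ε a) := by
    rw [fstD_mid (by omega) (by omega), sndD_mid (by omega) (by omega)] at gm
    rw [fstD_last, sndD_last] at gm'
    have hg : ∀ a : ℕ, 2 * m ≤ a → a ≤ 2 * m + 1 →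
        qform (2 * m + 1) ε (rootP (2 * m + 1) (2 * m - 1)) (rootP (2 * m + 1) a) = p⁻¹ := by
      intro a ha ha'
      obtain rfl | rfl : a = 2 * m ∨ a = 2 * m + 1 := by omega
      · exact gm
      · exact gm'
    intro a b ha ha' hb hb' hab
    have hga : qform (2 * m + 1) ε (rootP (2 * m + 1) a) (rootP (2 * m + 1) (2 * m - 1)) = p⁻¹ :=
      (qform_comm _ _).trans (hg a ha ha')
    -- `Triangular.bracket_fork` expects the shared letter last in the `e`-bracket and first in the
    -- `f`-bracket, so both are reversed.
    rw [bracket_eq_smul hd0 (UD.e (2 * m + 1) ε a),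
      bracket_inv_eq_smul hd0 (UD.f (2 * m + 1) ε (2 * m - 1))]
    refine smul_mul_smul_comm_of_comm (K := Kq) (A := UD (2 * m + 1) ε) ?_ _ _
    have := T.bracket_fork (a := a) (b := b) (u := 2 * m - 1) (c := d⁻¹) (by omega) (by omega)
      (by omega) hab (by omega) (by omega) (qform_comm _ _) ((hg b hb hb').trans hga.symm) (by
        rw [hga, inv_inv]
        exact hdinv.symm)
    rw [inv_inv] at this
    exact this
  have cases : ∀ i, i ≤ m + 1 → (i = 0 ∧ fstD m i = 0 ∧ sndD m i = 2) ∨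
      (i = m + 1 ∧ fstD m i = 2 * m - 1 ∧ sndD m i = 2 * m + 1) ∨
      (i ≠ 0 ∧ i ≠ m + 1 ∧ fstD m i = 2 * i - 1 ∧ sndD m i = 2 * i) := by
    intro i hi
    rcases eq_or_ne i 0 with rfl | h0
    · exact .inl ⟨rfl, fstD_zero m, sndD_zero m⟩
    rcases eq_or_ne i (m + 1) with rfl | h1
    · exact .inr (.inl ⟨rfl, fstD_last m, sndD_last m⟩)
    · exact .inr (.inr ⟨h0, h1, fstD_mid h0 h1, sndD_mid h0 h1⟩)
  have ci := cases i hi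
  have cj := cases j hj
  by_cases h01 : i ≤ 1 ∧ j ≤ 1
  · have e : ∀ i, i ≤ 1 → fstD m i = i ∧ sndD m i = 2 := by
      intro i hi
      have := cases i (by omega)
      omega
    rw [(e i h01.1).1, (e i h01.1).2, (e j h01.2).1, (e j h01.2).2]
    exact head i j h01.1 h01.2 hij
  by_cases hmm : m ≤ i ∧ m ≤ j
  · have e : ∀ i, i ≤ m + 1 → m ≤ i → fstD m i = 2 * m - 1 ∧ sndD m i = m + i := by
      intro i hi hi'
      have := cases i hi
      omega
    rw [(e i hi hmm.1).1, (e i hi hmm.1).2, (e j hj hmm.2).1, (e j hj hmm.2).2]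
    exact tail (m + i) (m + j) (by omega) (by omega) (by omega) (by omega) (by omega)
  · exact bracket_mul_bracket_of_ne T (by omega)

/-- The homomorphism from the quantum affine algebra of type `D_{m+1}^{(1)}`. -/
theorem IsAlternating.exists_typeD (H : IsAlternating ε p) (hp' : p' = -p⁻¹) (hm : 2 ≤ m)
    {d r r' : Kq} (hd : d = p ∨ d = p⁻¹) (hr : r * r' = 1) :
    ∃ φ : UqD p' (m + 1) →ₐ[Kq] UD (2 * m + 1) ε, SendsGenerators φ
      (fun i => r • bracket d (UD.e (2 * m + 1) ε (fstD m i.val))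
        (UD.e (2 * m + 1) ε (sndD m i.val)))
      (fun i => r' • bracket d⁻¹ (UD.f (2 * m + 1) ε (sndD m i.val))
        (UD.f (2 * m + 1) ε (fstD m i.val)))
      (fun i => UD.k (2 * m + 1) ε (fstD m i.val) * UD.k (2 * m + 1) ε (sndD m i.val)) := by
  have h0 := H.ne_zero
  have hle : ∀ i : Fin (m + 1 + 1), i.val ≤ m + 1 := fun i => by have := i.isLt; omega
  have hlt : ∀ i : Fin (m + 1 + 1), fstD m i.val < sndD m i.val ∧ sndD m i.val ≤ 2 * m + 1 := by
    intro i
    have := hle i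
    unfold fstD sndD
    split_ifs <;> omega
  refine exists_sendsGenerators_of_pairs (UD.triangular (n := 2 * m + 1) (ε := ε))
    (fst := fun i : Fin (m + 1 + 1) => fstD m i.val)
    (snd := fun i : Fin (m + 1 + 1) => sndD m i.val) (t := fun _ => d) (r := fun _ => r)
    (r' := fun _ => r') (fun i => (hlt i).1.le.trans (hlt i).2) (fun i => (hlt i).2)
    (fun i => (hlt i).1.ne) ?_ (fun i => qform_comm _ _) ?_ ?_ ?_ ?_
  · intro i
    rw [H.qform_pairD_self hm (hle i), inv_inv]
    exact hd.symm
  · intro i j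
    rw [H.qform_pair, (weightedDot_pairD hm i j).1, (weightedDot_pairD hm i j).2, zpow_zero,
      one_mul, pow_symmetrizer_simpleD p' hm, cartan_simpleD hm, hp']
  · intro i
    rw [H.qform_pairD_self hm (hle i), pow_symmetrizer_simpleD p' hm, H.sub_inv]
    exact normalization_odd h0 (H.pow_ne_one' (by norm_num)) hp' hr
  · intro i j hij
    exact H.bracket_pairD_comm hm hd (fun h => hij (Fin.ext h)) (hle i) (hle j)
  · intro x hx i j hij s s'
    rcases hx with rfl | rfl
    · exact H.serre_pairD hp' hm (H.halfSystem hm fun _ => UD.halfRel_e) hd hij s s'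
    · exact H.serre_pairD hp' hm (H.halfSystem hm fun _ => UD.halfRel_f) hd hij s s'

end TypeD

/-! ### Specialization to `p = q` and `p = q̃`. -/

theorem qint_two_q : qint q 2 = q + q⁻¹ := qint_two (q_pow_ne_one (by norm_num)) q_ne_zero

theorem qt_add_inv : qt + qt⁻¹ = -(q + q⁻¹) := by
  rw [inv_qt, qt]
  ring

section Scalars

variable {K : Type*} [Field K]

theorem one_div_pow_one_mul {s : K} (hs : s ≠ 0) : 1 / s ^ 1 * (1 / s ^ 1) * s ^ 2 = 1 := by
  field_simp

theorem neg_one_div_pow_one_mul {s c : K} (hs : s ≠ 0) (hc : c ≠ 0) :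
    (-(1 / s)) ^ 1 * -c * ((-(1 / s)) ^ 1 * -c⁻¹) * (-s) ^ 2 = 1 := by
  field_simp

theorem neg_mul_neg_inv {c : K} (hc : c ≠ 0) : -c * -c⁻¹ = 1 := by
  field_simp

theorem neg_pow_eta {a : K} (η : ℤ) (hη : η = 1 ∨ η = -1) :
    -a ^ η = -a ∨ -a ^ η = -a⁻¹ := by
  rcases hη with rfl | rfl
  · exact .inl (by rw [zpow_one])
  · exact .inr (by rw [zpow_neg_one])

theorem neg_pow_two_eta {a : K} (η : ℤ) (hη : η = 1 ∨ η = -1) :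
    -a ^ (2 * η) = -a ^ 2 ∨ -a ^ (2 * η) = -(a ^ 2)⁻¹ := by
  rcases hη with rfl | rfl
  · left; norm_cast
  · right; rw [← zpow_natCast, ← zpow_neg]; norm_num

theorem inv_pow_eta {a : K} (η : ℤ) (hη : η = 1 ∨ η = -1) :
    (a ^ η)⁻¹ = a⁻¹ ∨ (a ^ η)⁻¹ = a := by
  rcases hη with rfl | rfl
  · exact .inl (by rw [zpow_one])
  · exact .inr (by rw [zpow_neg_one, inv_inv])

theorem inv_neg_pow_two_eta {a b : K} (hb : b ^ 2 = (a ^ 2)⁻¹) (η : ℤ) (hη : η = 1 ∨ η = -1) :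
    (-a ^ (2 * η))⁻¹ = -b ^ 2 ∨ (-a ^ (2 * η))⁻¹ = -(b ^ 2)⁻¹ := by
  rw [hb, inv_inv]
  rcases neg_pow_two_eta (a := a) η hη with h | h <;> rw [h, inv_neg]
  · exact .inl rfl
  · rw [inv_inv]; exact .inr rfl

end Scalars

theorem ends_eq_one {m i : ℕ} (hm : 2 ≤ m) (h : i = 0 ∨ i = m) : ends m i = 1 := by
  unfold ends
  split_ifs <;> omega

theorem ends_eq_zero {m i : ℕ} (h : ¬(i = 0 ∨ i = m)) : ends m i = 0 := by
  unfold ends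
  split_ifs <;> omega

theorem qint_two_q_ne_zero : qint q 2 ≠ 0 :=
  qint_ne_zero (q_pow_ne_one (by norm_num)) q_ne_zero (q_pow_ne_one (by norm_num))

theorem TypeC.exists_hat {m : ℕ} (hm : 2 ≤ m) {η : ℤ} (hη : η = 1 ∨ η = -1) :
    ∃ φ : UqC q m →ₐ[Kq] UD (2 * m + 1) epsC,
      SendsGenerators φ (TypeC.hatE m η) (TypeC.hatF m η) (TypeC.hatK m) := by
  refine isAlternating_epsC.exists_typeC hm (c := fun i => TypeC.c m η i.val)
    (r := fun i => 1 / qint q 2 ^ ends m i.val) (r' := fun i => 1 / qint q 2 ^ ends m i.val)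
    (fun i h => ?_) (fun i h => ?_) (fun i h => ?_) (fun i h => ?_)
  · simp only [TypeC.c, if_pos h]
    exact neg_pow_two_eta η hη
  · simp only [TypeC.c, if_neg h]
    exact neg_pow_eta η hη
  · rw [ends_eq_one hm h, ← qint_two_q]
    exact one_div_pow_one_mul qint_two_q_ne_zero
  · rw [ends_eq_zero h, pow_zero, div_one, one_mul]

theorem TypeC.exists_check {m : ℕ} (hm : 2 ≤ m) {d : Kq} (hd : d = q ∨ d = q⁻¹) :
    ∃ φ : UqD qt (m + 1) →ₐ[Kq] UD (2 * m + 1) epsC,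
      SendsGenerators φ (TypeC.checkE m d) (TypeC.checkF m d) (TypeC.checkK m) := by
  obtain ⟨φ, hφ⟩ := isAlternating_epsC.exists_typeD (p' := qt) rfl hm hd (mul_one (1 : Kq))
  refine ⟨φ, fun j => ?_⟩
  obtain ⟨h1, h2, h3⟩ := hφ j
  beta_reduce at h1 h2 h3
  rw [h1, h2, h3, one_smul, one_smul]
  unfold TypeC.checkE TypeC.checkF TypeC.checkK fstD sndD
  split_ifs <;> exact ⟨rfl, rfl, rfl⟩

theorem TypeD.c_ne_zero (m : ℕ) (η : ℤ) (i : ℕ) : TypeD.c m η i ≠ 0 := by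
  unfold TypeD.c
  split_ifs
  · exact neg_ne_zero.2 (zpow_ne_zero _ q_ne_zero)
  · exact zpow_ne_zero _ q_ne_zero

theorem TypeD.exists_hat {m : ℕ} (hm : 2 ≤ m) {η : ℤ} (hη : η = 1 ∨ η = -1) :
    ∃ φ : UqC qt m →ₐ[Kq] UD (2 * m + 1) epsD,
      SendsGenerators φ (TypeD.hatE m η) (TypeD.hatF m η) (TypeD.hatK m) := by
  have hsq : qt ^ 2 = (q ^ 2)⁻¹ := by rw [qt, Even.neg_pow (by decide), inv_pow]
  -- The brackets of (3) are reversed, so the general result is used at `c⁻¹`; the factors `-c` and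
  -- `-c⁻¹` from the reversal go into `r` and `r'`, where they cancel in the product.
  obtain ⟨φ, hφ⟩ := isAlternating_epsD.exists_typeC hm (c := fun i => (TypeD.c m η i.val)⁻¹)
    (r := fun i => (-(1 / qint q 2)) ^ ends m i.val * -TypeD.c m η i.val)
    (r' := fun i => (-(1 / qint q 2)) ^ ends m i.val * -(TypeD.c m η i.val)⁻¹)
    (fun i h => by
      simp only [TypeD.c, if_pos h]
      exact inv_neg_pow_two_eta hsq η hη)
    (fun i h => by
      simp only [TypeD.c, if_neg h]
      rw [inv_qt, qt, neg_neg, neg_neg]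
      exact inv_pow_eta η hη)
    (fun i h => by
      rw [ends_eq_one hm h, qt_add_inv, ← qint_two_q]
      exact neg_one_div_pow_one_mul qint_two_q_ne_zero (TypeD.c_ne_zero m η i.val))
    (fun i h => by
      rw [ends_eq_zero h, pow_zero, one_mul, one_mul]
      exact neg_mul_neg_inv (TypeD.c_ne_zero m η i.val))
  refine ⟨φ, fun i => ?_⟩
  have hc := TypeD.c_ne_zero m η i.val
  obtain ⟨h1, h2, h3⟩ := hφ i
  refine ⟨h1.trans ?_, h2.trans ?_, h3⟩
  · beta_reduce
    rw [mul_smul, ← bracket_eq_smul hc]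
    rfl
  · beta_reduce
    rw [mul_smul, inv_inv, ← bracket_inv_eq_smul hc]
    rfl

theorem TypeD.exists_check {m : ℕ} (hm : 2 ≤ m) {d : Kq} (hd : d = -q ∨ d = -q⁻¹) :
    ∃ φ : UqD q (m + 1) →ₐ[Kq] UD (2 * m + 1) epsD,
      SendsGenerators φ (TypeD.checkE m d) (TypeD.checkF m d) (TypeD.checkK m) := by
  have hd' : d = qt ∨ d = qt⁻¹ := by
    rw [inv_qt]
    exact hd.symm
  have hd0 : d ≠ 0 := by
    rcases hd' with rfl | rfl
    · exact isAlternating_epsD.ne_zero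
    · exact inv_ne_zero isAlternating_epsD.ne_zero
  have hdinv : d⁻¹ = qt ∨ d⁻¹ = qt⁻¹ := by
    rcases hd' with rfl | rfl
    · exact .inr rfl
    · exact .inl (inv_inv qt)
  have hq : q = -qt⁻¹ := by rw [inv_qt, neg_neg]
  -- The general result is used at `d⁻¹` with scalars `-d` and `-d⁻¹`, which compensate for the
  -- reversed brackets.
  obtain ⟨φ, hφ⟩ := isAlternating_epsD.exists_typeD hq hm hdinv (neg_mul_neg_inv hd0)
  refine ⟨φ, fun j => ?_⟩
  obtain ⟨h1, h2, h3⟩ := hφ j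
  beta_reduce at h1 h2 h3
  rw [h1, h2, h3, inv_inv, ← bracket_eq_smul hd0, ← bracket_inv_eq_smul hd0]
  unfold TypeD.checkE TypeD.checkF TypeD.checkK fstD sndD
  split_ifs <;> exact ⟨rfl, rfl, rfl⟩

end QuantumD

theorem mainTheorem4 (m : ℕ) (hm : 2 ≤ m) :
    (∀ η : ℤ, η = 1 ∨ η = -1 →
      ∃ φ : UqC q m →ₐ[Kq] UD (2 * m + 1) epsC,
        SendsGenerators φ (TypeC.hatE m η) (TypeC.hatF m η) (TypeC.hatK m)) ∧
    (∀ d : Kq, d = q ∨ d = q⁻¹ →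
      ∃ φ : UqD qt (m + 1) →ₐ[Kq] UD (2 * m + 1) epsC,
        SendsGenerators φ (TypeC.checkE m d) (TypeC.checkF m d) (TypeC.checkK m)) ∧
    (∀ η : ℤ, η = 1 ∨ η = -1 →
      ∃ φ : UqC qt m →ₐ[Kq] UD (2 * m + 1) epsD,
        SendsGenerators φ (TypeD.hatE m η) (TypeD.hatF m η) (TypeD.hatK m)) ∧
    (∀ d : Kq, d = -q ∨ d = -q⁻¹ →
      ∃ φ : UqD q (m + 1) →ₐ[Kq] UD (2 * m + 1) epsD,
        SendsGenerators φ (TypeD.checkE m d) (TypeD.checkF m d) (TypeD.checkK m)) :=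
  ⟨fun _ hη => TypeC.exists_hat hm hη, fun _ hd => TypeC.exists_check hm hd,
    fun _ hη => TypeD.exists_hat hm hη, fun _ hd => TypeD.exists_check hm hd⟩
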